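/- All topological groups and vector spaces are Hausdorff and vector spaces are real. A map $f\colon U\to F$ from an open subset $U$ of a locally convex space $E$ to a locally convex space $F$ is smooth if it is continuous, all iterated directional derivatives $\mathrm{d}^jf(x)(h_1,\dots,h_j)=(\partial_{h_j}\cdots\partial_{h_1}f)(x)$ exist, and all the maps $\mathrm{d}^jf\colon U\times E^j\to F$, $j\ge 1$, are continuous. A Lie group is a group with the structure of a smooth manifold modelled on a locally convex space (in this sense of smoothness) whose multiplication and inversion are smooth. An exponential function of a Lie group $G$ with Lie algebra $\mathfrak g=T_{\mathbf 1}(G)$ is a smooth map $\exp_G\colon\mathfrak g\to G$ such that for every $x\in\mathfrak g$ the curve $\gamma_x(t)=\exp_G(tx)$ is a one-parameter group with $\gamma_x'(0)=x$. The Lie group $G$ has the Trotter property if it has an exponential function and, for all $x_1,x_2\in\mathfrak g$, $$\exp_G(t(x_1+x_2))=\lim_{n\to\infty}\Big(\exp_G\big(\tfrac tn x_1\big)\exp_G\big(\tfrac tn x_2\big)\Big)^n$$ uniformly for $t$ in compact subsets of $\mathbb R$; here $\gamma_n\to\gamma$ uniformly on $S\subseteq\mathbb R$ means that for every $\mathbf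 1$-neighborhood $U\subseteq G$ there is an $N$ such that $\gamma_n(s)\in\gamma(s)U$ for all $s\in S$ and $n\ge N$. **Proposition.** Let $G$ be a Lie group modelled on a locally convex space, let $V$ be a complete locally convex space, and let $\alpha\colon G\to \mathrm{GL}(V)$ be a homomorphism into the group of topological linear automorphisms of $V$ such that the action map $G\times V\to V$, $(g,v)\mapsto\alpha(g)v$, is smooth. Then the semidirect product $H:=V\rtimes_\alpha G$, that is, the product manifold $V\times G$ with the multiplication $(v,g)(w,h)=(v+\alpha(g)w,\,gh)$, is a Lie group, and if $G$ has the Trotter property, then so does $H$. -/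

import Mathlib

open Set Filter Topology

/-! ### Smooth maps between locally convex spaces -/

section Calculus

variable {E F : Type*} [AddCommGroup E] [Module ℝ E] [AddCommGroup F] [Module ℝ F]
  [TopologicalSpace F]

/-- `y` is the derivative of `f` at `x` in the direction `h`:
`y = lim_{t → 0} t⁻¹ (f (x + t h) - f x)`. -/
def HasDirDerivAt (f : E → F) (x h : E) (y : F) : Prop :=
  Tendsto (fun t : ℝ => t⁻¹ • (f (x + t • h) - f x)) (𝓝[≠] 0) (𝓝 y)

/-- Smoothness of `f` on an open set `U` of a locally convex space: `f` is continuous on `U`, all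
iterated directional derivatives `D j x (h₁, …, h_j) = (∂_{h_j} ⋯ ∂_{h_1} f) x` exist for `x ∈ U`,
and each `D j` is continuous on `U × E ^ j`. (When `F` is Hausdorff the values of `D` on `U` are
determined by `f`. The continuity of `f` itself is the case `j = 0`.) -/
def LCSmoothOn [TopologicalSpace E] (f : E → F) (U : Set E) : Prop :=
  ∃ D : (j : ℕ) → E → (Fin j → E) → F,
    (∀ x ∈ U, ∀ h : Fin 0 → E, D 0 x h = f x) ∧
    (∀ j, ContinuousOn (fun p : E × (Fin j → E) => D j p.1 p.2) (U ×ˢ univ)) ∧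
    (∀ j, ∀ x ∈ U, ∀ (h : Fin j → E) (k : E),
      HasDirDerivAt (fun y => D j y h) x k (D (j + 1) x (Fin.snoc h k)))

end Calculus

/-! ### Manifolds and Lie groups modelled on locally convex spaces -/

section Manifolds

variable (E : Type*) [AddCommGroup E] [Module ℝ E] [TopologicalSpace E]
  (F : Type*) [AddCommGroup F] [Module ℝ F] [TopologicalSpace F]

/-- The charts of the atlas of `M` are smoothly compatible. -/
def HasSmoothAtlas (M : Type*) [TopologicalSpace M] [ChartedSpace E M] : Prop :=
  ∀ e ∈ atlas E M, ∀ e' ∈ atlas E M,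
    LCSmoothOn (fun x => e' (e.symm x)) (e.target ∩ e.symm ⁻¹' e'.source)

/-- `f : M → N` is smooth: it is continuous and smooth in all charts of the two atlases. -/
def IsLCSmooth {M N : Type*} [TopologicalSpace M] [ChartedSpace E M]
    [TopologicalSpace N] [ChartedSpace F N] (f : M → N) : Prop :=
  Continuous f ∧ ∀ e ∈ atlas E M, ∀ e' ∈ atlas F N,
    LCSmoothOn (fun x => e' (f (e.symm x))) (e.target ∩ e.symm ⁻¹' (f ⁻¹' e'.source))

/-- The product manifold structure on `M × N`, modelled on the locally convex space `E × F`; its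
charts are the products of a chart of `M` and a chart of `N`. -/
@[reducible]
def lcProdChartedSpace (M N : Type*) [TopologicalSpace M] [ChartedSpace E M]
    [TopologicalSpace N] [ChartedSpace F N] : ChartedSpace (E × F) (M × N) :=
  prodChartedSpace E M F N

/-- `G` is a (Hausdorff) Lie group modelled on the locally convex space `E`. -/
structure IsLCLieGroup (G : Type*) [Group G] [TopologicalSpace G] [ChartedSpace E G] : Prop where
  t2Space : T2Space G
  hasSmoothAtlas : HasSmoothAtlas E G
  smooth_mul :
    letI := lcProdChartedSpace E E G G
    IsLCSmooth (E × E) E (fun p : G × G => p.1 * p.2)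
  smooth_inv : IsLCSmooth E E (fun g : G => g⁻¹)

end Manifolds

/-! ### Exponential functions and the Trotter property -/

section Trotter

/-- The sequence `γn` converges to `γ` uniformly on `S`: for each neighbourhood `U` of `1`,
`γn n s ∈ γ s • U` for all `s ∈ S` and all large `n`. -/
def GroupTendstoUniformlyOn {G : Type*} [Group G] [TopologicalSpace G]
    (γn : ℕ → ℝ → G) (γ : ℝ → G) (S : Set ℝ) : Prop :=
  ∀ U ∈ 𝓝 (1 : G), ∃ N : ℕ, ∀ n ≥ N, ∀ s ∈ S, (γ s)⁻¹ * γn n s ∈ U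

/-- `X = X₁ + X₂` for one-parameter groups: `X t = lim (X₁ (t / n) * X₂ (t / n)) ^ n`, uniformly in
`t` on compact subsets of `ℝ`. -/
def IsTrotterSum {G : Type*} [Group G] [TopologicalSpace G] (X X₁ X₂ : ℝ → G) : Prop :=
  ∀ K : Set ℝ, IsCompact K →
    GroupTendstoUniformlyOn (fun n t => (X₁ (t / n) * X₂ (t / n)) ^ n) X K

variable (E : Type*) [AddCommGroup E] [Module ℝ E] [TopologicalSpace E]
  {G : Type*} [Group G] [TopologicalSpace G] [ChartedSpace E G]

/-- `ex` is a (smooth) exponential function of the Lie group `G`. The Lie algebra `T_1 G` is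
identified with the model space `E` by means of the preferred chart at `1`. Each curve
`γ_x t = ex (t x)` is a one-parameter group, and `γ_x' 0 = x`. -/
structure IsExpFunction (ex : E → G) : Prop where
  smooth : IsLCSmooth E E ex
  map_add_smul : ∀ (s t : ℝ) (x : E), ex ((s + t) • x) = ex (s • x) * ex (t • x)
  deriv_zero : ∀ x : E,
    HasDirDerivAt (fun t : ℝ => chartAt E (1 : G) (ex (t • x))) 0 1 x

variable (G) in
/-- The Trotter property: `G` has a smooth exponential function (which is then unique), and
`γ_{x₁ + x₂} = γ_{x₁} + γ_{x₂}` for the one-parameter groups `γ_x t = ex (t x)`. -/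
def HasTrotterProperty : Prop :=
  ∃ ex : E → G, IsExpFunction E ex ∧
    ∀ x₁ x₂ : E, IsTrotterSum (fun t => ex (t • (x₁ + x₂)))
      (fun t => ex (t • x₁)) (fun t => ex (t • x₂))

end Trotter

/-! ### Smooth linear actions and semidirect products -/

section Semidirect

variable {V : Type*} [AddCommGroup V] [Module ℝ V] [TopologicalSpace V]
  {G : Type*} [Group G]

/-- `α : G → GL(V)` defines a smooth action: the map `(g, v) ↦ α g v` is smooth on `G × V`. -/
def IsSmoothAction (E : Type*) [AddCommGroup E] [Module ℝ E] [TopologicalSpace E]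
    [TopologicalSpace G] [ChartedSpace E G] (α : G →* (V ≃L[ℝ] V)) : Prop :=
  letI := lcProdChartedSpace E V G V
  IsLCSmooth (E × V) V (fun p : G × V => α p.1 p.2)

/-- A linear action of `G` on `V`, viewed as an action by automorphisms of the group `(V, +)`. -/
def actionHom (α : G →* (V ≃L[ℝ] V)) : G →* MulAut (Multiplicative V) where
  toFun g := AddEquiv.toMultiplicative (α g).toLinearEquiv.toAddEquiv
  map_one' := by rw [map_one]; rfl
  map_mul' g h := by rw [map_mul]; rfl

/-- The semidirect product group `V ⋊_α G`: pairs `(v, g)` with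
`(v, g) (w, h) = (v + α g w, g h)`. -/
abbrev VecSemidirect (α : G →* (V ≃L[ℝ] V)) : Type _ :=
  Multiplicative V ⋊[actionHom α] G

namespace VecSemidirect

/-- The bijection `(v, g) ↦ (v, g)` from `V × G` to `V ⋊_α G`. -/
def ofProd (α : G →* (V ≃L[ℝ] V)) : V × G ≃ VecSemidirect α where
  toFun p := ⟨Multiplicative.ofAdd p.1, p.2⟩
  invFun h := (h.left.toAdd, h.right)

/-- `V ⋊_α G` carries the product topology of `V × G`. -/
instance instTopologicalSpace [TopologicalSpace G] (α : G →* (V ≃L[ℝ] V)) :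
    TopologicalSpace (VecSemidirect α) :=
  TopologicalSpace.induced (ofProd α).symm inferInstance

/-- `ofProd` as a homeomorphism. -/
def homeoProd [TopologicalSpace G] (α : G →* (V ≃L[ℝ] V)) : V × G ≃ₜ VecSemidirect α :=
  ((ofProd α).symm.toHomeomorphOfIsInducing ⟨rfl⟩).symm

/-- `V ⋊_α G` carries the product manifold structure of `V × G`, modelled on `V × E`. -/
instance instChartedSpace (E : Type*) [TopologicalSpace E]
    [AddCommGroup E] [Module ℝ E] [TopologicalSpace G] [ChartedSpace E G]
    (α : G →* (V ≃L[ℝ] V)) : ChartedSpace (V × E) (VecSemidirect α) :=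
  letI := lcProdChartedSpace V E V G
  { atlas := (fun e => (homeoProd α).symm.transOpenPartialHomeomorph e) '' atlas (V × E) (V × G)
    chartAt := fun h => (homeoProd α).symm.transOpenPartialHomeomorph
      (chartAt (V × E) ((homeoProd α).symm h))
    mem_chart_source := fun h => mem_chart_source (V × E) ((homeoProd α).symm h)
    chart_mem_atlas := fun h =>
      mem_image_of_mem _ (chart_mem_atlas (V × E) ((homeoProd α).symm h)) }

/-- The group law is the expected one. -/
theorem ofProd_mul (α : G →* (V ≃L[ℝ] V)) (v w : V) (g h : G) :
    ofProd α (v, g) * ofProd α (w, h) = ofProd α (v + α g w, g * h) :=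
  SemidirectProduct.ext (SemidirectProduct.mul_left _ _) (SemidirectProduct.mul_right _ _)

end VecSemidirect

end Semidirect

/-! Let `ex` be the exponential function of `G`. That of `V ⋊ G` is `(v, x) ↦ (∫₀¹ α (ex (s x)) v
ds, ex x)`. The integral exists as a limit of Riemann sums because `V` is complete; it depends
smoothly on `(v, x)` by differentiation under the integral sign (`lcSmoothOn_unitIntegral`), and
substitution together with additivity in the interval gives the one-parameter law
(`expLeft_add_smul`).

For the Trotter formula, put `g = ex (t/n x₁) * ex (t/n x₂)`. The product of the two exponentials at
time `t/n` has the form `(c/n, g)` with `c → t (v₁ + v₂)`, and its `n`-th power is `(n⁻¹ ∑_{k<n} α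
(g ^ k) c, g ^ n)`. The second component converges by hypothesis. The first is a Riemann sum whose
node `σ = k/n` carries `g ^ k`, which is itself a `k`-step Trotter product at time `σ t`, so it is
close to `ex (σ t (x₁ + x₂))`. Hence the sum tends to `∫₀¹ α (ex (σ t (x₁ + x₂))) (t (v₁ + v₂)) dσ`,
as required. Uniformity, in `t` and in the number `k` of factors, is handled throughout as
continuous convergence, that is, convergence along filters `𝓝 t ×ˢ atTop`, which compactness turns
into uniform convergence (`IsTrotterSum.tendsto`, `isTrotterSum_of_tendsto`, `tendsto_floor`).

The Lie group structure needs only that smooth maps compose. Smoothness is defined by a tower of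
iterated directional derivatives, for which the chain rule is awkward. It is therefore shown to be
equivalent, on open sets, to the existence and continuity of all iterated tangent maps
(`ContDirDiffOn`), for which the chain rule is a short induction. -/

set_option linter.unusedSectionVars false

/-! ### Directional derivatives, mean value theorem, pointwise chain rule -/

section DirectionalDerivatives

variable {E : Type*} [AddCommGroup E] [Module ℝ E]
  {F : Type*} [AddCommGroup F] [Module ℝ F] [TopologicalSpace F]

theorem HasDirDerivAt.unique [T2Space F] {f : E → F} {x h : E} {y z : F}
    (hy : HasDirDerivAt f x h y) (hz : HasDirDerivAt f x h z) : y = z :=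
  tendsto_nhds_unique hy hz

theorem HasDirDerivAt.smul_dir [ContinuousConstSMul ℝ F] {f : E → F} {x h : E} {y : F}
    (hf : HasDirDerivAt f x h y) (c : ℝ) : HasDirDerivAt f x (c • h) (c • y) := by
  rcases eq_or_ne c 0 with rfl | hc
  · simpa [HasDirDerivAt] using tendsto_const_nhds
  have hlim : Tendsto (fun t : ℝ => t * c) (𝓝[≠] 0) (𝓝[≠] 0) := by
    refine tendsto_nhdsWithin_iff.2 ⟨?_, ?_⟩
    · exact ((continuous_id.mul continuous_const).tendsto' (0 : ℝ) 0 (by simp)).mono_left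
        nhdsWithin_le_nhds
    · filter_upwards [self_mem_nhdsWithin] with t ht using mul_ne_zero ht hc
  refine ((Tendsto.comp hf hlim).const_smul c).congr fun t => ?_
  simp only [Function.comp, smul_smul, mul_inv]
  congr 1
  field_simp

theorem HasDirDerivAt.congr_of_eventuallyEq [TopologicalSpace E] [ContinuousAdd E]
    [ContinuousSMul ℝ E] {f g : E → F} {x h : E} {y : F}
    (hf : HasDirDerivAt f x h y) (hfg : f =ᶠ[𝓝 x] g) : HasDirDerivAt g x h y := by
  have hc : Tendsto (fun t : ℝ => x + t • h) (𝓝[≠] 0) (𝓝 x) :=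
    ((by fun_prop : Continuous fun t : ℝ => x + t • h).tendsto' 0 x (by simp)).mono_left
      nhdsWithin_le_nhds
  refine Tendsto.congr' ?_ hf
  filter_upwards [hc.eventually hfg] with t ht
  rw [ht, hfg.self_of_nhds]

theorem HasDirDerivAt.prodMk {F' : Type*} [AddCommGroup F'] [Module ℝ F'] [TopologicalSpace F']
    {f : E → F} {g : E → F'} {x h : E} {y : F} {z : F'}
    (hf : HasDirDerivAt f x h y) (hg : HasDirDerivAt g x h z) :
    HasDirDerivAt (fun p => (f p, g p)) x h (y, z) :=
  Tendsto.prodMk_nhds hf hg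

theorem HasDirDerivAt.add_fun [ContinuousAdd F] {f g : E → F} {x h : E} {y z : F}
    (hf : HasDirDerivAt f x h y) (hg : HasDirDerivAt g x h z) :
    HasDirDerivAt (fun p => f p + g p) x h (y + z) := by
  refine (Tendsto.add hf hg).congr fun t => ?_
  rw [← smul_add, add_sub_add_comm]

theorem HasDirDerivAt.const_smul_fun [ContinuousConstSMul ℝ F] {f : E → F} {x h : E} {y : F}
    (hf : HasDirDerivAt f x h y) (c : ℝ) : HasDirDerivAt (fun p => c • f p) x h (c • y) := by
  refine (Tendsto.const_smul hf c).congr fun t => ?_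
  rw [← smul_sub, smul_comm]

theorem HasDirDerivAt.comp_linearMap {E' : Type*} [AddCommGroup E'] [Module ℝ E']
    {f : E → F} (L : E' →ₗ[ℝ] E) {x h : E'} {y : F}
    (hf : HasDirDerivAt f (L x) (L h) y) : HasDirDerivAt (fun p => f (L p)) x h y := by
  simpa [HasDirDerivAt] using hf

theorem hasDirDerivAt_const (c : F) (x h : E) : HasDirDerivAt (fun _ : E => c) x h 0 := by
  simpa [HasDirDerivAt] using tendsto_const_nhds

theorem HasDirDerivAt.clm_comp {F' : Type*} [AddCommGroup F'] [Module ℝ F'] [TopologicalSpace F']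
    {f : E → F} {x h : E} {y : F} (hf : HasDirDerivAt f x h y) (L : F →L[ℝ] F') :
    HasDirDerivAt (fun p => L (f p)) x h (L y) := by
  refine ((L.continuous.tendsto y).comp hf).congr fun t => ?_
  simp

theorem HasDirDerivAt.hasDerivAt {f : E → ℝ} {x h : E} {y : ℝ} {τ : ℝ}
    (hf : HasDirDerivAt f (x + τ • h) h y) : HasDerivAt (fun s : ℝ => f (x + s • h)) y τ := by
  rw [hasDerivAt_iff_tendsto_slope_zero]
  refine Tendsto.congr (fun t => ?_) hf
  rw [add_smul, add_assoc]

variable [IsTopologicalAddGroup F] [ContinuousSMul ℝ F]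

/-- Mean value theorem: a difference quotient lies in each open convex set that contains all the
directional derivatives along the segment. -/
theorem smul_sub_mem_of_hasDirDerivAt {f : E → F} {x h : E} {t : ℝ}
    (ht : t ≠ 0) {d : ℝ → F} {C : Set F} (hC : Convex ℝ C) (hCo : IsOpen C)
    (hd : ∀ τ, |τ| ≤ |t| → HasDirDerivAt f (x + τ • h) h (d τ))
    (hmem : ∀ τ, |τ| ≤ |t| → d τ ∈ C) : t⁻¹ • (f (x + t • h) - f x) ∈ C := by
  by_contra hz
  -- A functional that is strictly smaller on `C` than at the quotient contradicts the scalar mean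
  -- value theorem, by which some derivative on the segment has the same `l`-value as the quotient.
  obtain ⟨l, hl⟩ := geometric_hahn_banach_open_point hC hCo hz
  -- Parametrizing the segment by `θ * t` with `θ` in `[0, 1]` treats both signs of `t` at once.
  have hder : ∀ θ : ℝ, |θ| ≤ 1 →
      HasDerivAt (fun s : ℝ => l (f (x + (s * t) • h))) (l (d (θ * t)) * t) θ := by
    intro θ hθ
    have h1 := ((hd (θ * t) (by rw [abs_mul]; nlinarith [abs_nonneg t])).clm_comp l).hasDerivAt
    exact h1.comp θ (hasDerivAt_mul_const t)
  obtain ⟨c, hc, hce⟩ := exists_hasDerivAt_eq_slope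
    (fun s : ℝ => l (f (x + (s * t) • h))) (fun θ => l (d (θ * t)) * t) zero_lt_one
    (fun θ hθ => (hder θ (abs_le.2 ⟨by linarith [hθ.1], hθ.2⟩)).continuousAt.continuousWithinAt)
    (fun θ hθ => hder θ (abs_le.2 ⟨by linarith [hθ.1], hθ.2.le⟩))
  have hlt := hl _ (hmem (c * t) (by
    rw [abs_mul, abs_of_pos hc.1]; nlinarith [abs_nonneg t, hc.2]))
  simp only [one_mul, zero_mul, zero_smul, add_zero, sub_zero, div_one] at hce
  rw [map_smul, map_sub, smul_eq_mul, ← hce] at hlt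
  field_simp at hlt
  exact lt_irrefl _ hlt

variable [LocallyConvexSpace ℝ F]

theorem exists_isOpen_convex_subset {y : F} {s : Set F} (hs : s ∈ 𝓝 y) :
    ∃ C ⊆ s, IsOpen C ∧ Convex ℝ C ∧ y ∈ C := by
  obtain ⟨W, ⟨hW, hWc⟩, hWs⟩ := (LocallyConvexSpace.convex_basis (𝕜 := ℝ) y).mem_iff.1 hs
  exact ⟨interior W, interior_subset.trans hWs, isOpen_interior, hWc.interior,
    mem_interior_iff_mem_nhds.2 hW⟩

variable [TopologicalSpace E] [IsTopologicalAddGroup E] [ContinuousSMul ℝ E]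

/-- Strict differentiability in the directions of a filter `l`, from the existence and continuity
of the directional derivatives. -/
theorem tendsto_smul_sub_of_hasDirDerivAt {f : E → F} {x h : E} {l : Filter E} (hl : l ≤ 𝓝 h)
    {d : E → E → F} {w : F} (hd : ∀ᶠ p : E × E in 𝓝 x ×ˢ l, HasDirDerivAt f p.1 p.2 (d p.1 p.2))
    (hc : Tendsto (fun p : E × E => d p.1 p.2) (𝓝 x ×ˢ l) (𝓝 w)) :
    Tendsto (fun p : E × E × ℝ => p.2.2⁻¹ • (f (p.1 + p.2.2 • p.2.1) - f p.1))
      (𝓝 x ×ˢ l ×ˢ 𝓝[≠] 0) (𝓝 w) := by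
  intro s hs
  obtain ⟨C, hCs, hCo, hC, hwC⟩ := exists_isOpen_convex_subset hs
  obtain ⟨N, hN, M, hM, hNM⟩ := mem_prod_iff.1 (hd.and (hc.eventually (hCo.mem_nhds hwC)))
  have hcont : Tendsto (fun p : E × E × ℝ => p.1 + p.2.2 • p.2.1) (𝓝 x ×ˢ l ×ˢ 𝓝 0) (𝓝 x) := by
    have h1 : Continuous fun p : E × E × ℝ => p.1 + p.2.2 • p.2.1 := by fun_prop
    have h2 := h1.tendsto' (x, h, 0) x (by simp)
    rw [nhds_prod_eq, nhds_prod_eq] at h2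
    exact h2.mono_left (prod_mono le_rfl (prod_mono hl le_rfl))
  obtain ⟨N', hN', A, hA, hNA⟩ := mem_prod_iff.1 (hcont hN)
  obtain ⟨M', hM', B, hB, hMB⟩ := mem_prod_iff.1 hA
  obtain ⟨ε, hε, hεB⟩ := Metric.mem_nhds_iff.1 hB
  have hball : Metric.ball (0 : ℝ) ε ∩ {0}ᶜ ∈ 𝓝[≠] (0 : ℝ) :=
    inter_mem (mem_nhdsWithin_of_mem_nhds (Metric.ball_mem_nhds _ hε)) self_mem_nhdsWithin
  refine mem_map.2 (mem_of_superset
    (prod_mem_prod hN' (prod_mem_prod (inter_mem hM hM') hball)) ?_)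
  rintro ⟨x', h', t⟩ ⟨hx', ⟨hh', hh''⟩, ht, ht0⟩
  have hseg : ∀ τ : ℝ, |τ| ≤ |t| → x' + τ • h' ∈ N := fun τ hτ =>
    hNA (a := (x', h', τ)) ⟨hx', hMB (a := (h', τ)) ⟨hh'', hεB (by
      rw [mem_ball_zero_iff, Real.norm_eq_abs] at ht ⊢; exact hτ.trans_lt ht)⟩⟩
  exact hCs (smul_sub_mem_of_hasDirDerivAt (d := fun τ => d (x' + τ • h') h') ht0 hC hCo
    (fun τ hτ => (hNM (a := (x' + τ • h', h')) ⟨hseg τ hτ, hh'⟩).1)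
    (fun τ hτ => (hNM (a := (x' + τ • h', h')) ⟨hseg τ hτ, hh'⟩).2))

/-- If the derivatives in the direction `k` exist near `x` and are continuous at `x`, then the
derivatives at `x` in the directions `h` and `k` add up. -/
theorem HasDirDerivAt.add_dir {f : E → F} {x h k : E} {y : F} {d : E → F}
    (hf : HasDirDerivAt f x h y) (hd : ∀ᶠ x' in 𝓝 x, HasDirDerivAt f x' k (d x'))
    (hc : ContinuousAt d x) : HasDirDerivAt f x (h + k) (y + d x) := by
  -- The increment along `t (h + k)` is split at `x + t h`. In the second half the direction `k` is
  -- fixed, hence `pure k`, while the base point moves, so strict differentiability is needed.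
  have h1 := tendsto_smul_sub_of_hasDirDerivAt (f := f) (x := x) (l := pure k) (pure_le_nhds k)
    (d := fun x' _ => d x') (w := d x)
    (by
      rw [prod_pure, eventually_map]
      exact hd)
    (by
      rw [prod_pure, tendsto_map'_iff]
      exact hc)
  have hx : Tendsto (fun t : ℝ => x + t • h) (𝓝[≠] 0) (𝓝 x) :=
    ((by fun_prop : Continuous fun t : ℝ => x + t • h).tendsto' 0 x (by simp)).mono_left
      nhdsWithin_le_nhds
  have hk : Tendsto (fun _ : ℝ => k) (𝓝[≠] 0) (pure k) := tendsto_pure.2 (.of_forall fun _ => rfl)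
  have h2 := h1.comp (hx.prodMk (hk.prodMk tendsto_id))
  refine (Tendsto.add hf h2).congr fun t => ?_
  simp only [Function.comp, id]
  rw [← smul_add, smul_add t h k, add_assoc]
  congr 1
  abel

/-- Writing `f (x + t h) = f x + t q` with `q → y`, the quotient of the composite is the quotient of
`g` at `f x` in the moving direction `q`. This is why strict differentiability was proved with
varying directions. -/
theorem HasDirDerivAt.comp {E' : Type*} [AddCommGroup E'] [Module ℝ E'] {g : E → F} {f : E' → E} {x h : E'} {y : E} {d : E × E → F}
    (hf : HasDirDerivAt f x h y)
    (hg : ∀ᶠ p : E × E in 𝓝 (f x, y), HasDirDerivAt g p.1 p.2 (d p))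
    (hd : ContinuousAt d (f x, y)) :
    HasDirDerivAt (fun p => g (f p)) x h (d (f x, y)) := by
  have h1 := tendsto_smul_sub_of_hasDirDerivAt (f := g) (x := f x) (l := 𝓝 y) le_rfl
    (d := fun a b => d (a, b)) (w := d (f x, y)) (by rw [← nhds_prod_eq]; exact hg)
    (by rw [← nhds_prod_eq]; exact hd)
  have h2 := h1.comp ((tendsto_const_nhds (x := f x)).prodMk (Tendsto.prodMk hf tendsto_id))
  refine h2.congr' ?_
  filter_upwards [self_mem_nhdsWithin] with t ht
  simp only [Function.comp, id]
  rw [smul_smul, mul_inv_cancel₀ ht, one_smul, add_sub_cancel]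

end DirectionalDerivatives

/-! ### Finite-order differentiability through iterated tangent maps -/

section ContDirDiff

universe u v w

section Basic

variable {F : Type v} [AddCommGroup F] [Module ℝ F] [TopologicalSpace F]

/-- The derivative of `f` at `p.1` in the direction `p.2` (a junk value if there is none). -/
noncomputable def dirDeriv {E : Type u} [AddCommGroup E] [Module ℝ E] (f : E → F) (p : E × E) : F :=
  limUnder (𝓝[≠] (0 : ℝ)) fun t : ℝ => t⁻¹ • (f (p.1 + t • p.2) - f p.1)

theorem HasDirDerivAt.dirDeriv_eq [T2Space F] {E : Type u} [AddCommGroup E] [Module ℝ E]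
    {f : E → F} {x h : E} {y : F} (hf : HasDirDerivAt f x h y) : dirDeriv f (x, h) = y :=
  Tendsto.limUnder_eq hf

/-- `f` is `k` times continuously differentiable on `U`, in the sense that the iterated tangent maps
exist and are continuous. -/
def ContDirDiffOn : ℕ → ∀ {E : Type u} [AddCommGroup E] [Module ℝ E] [TopologicalSpace E],
    (E → F) → Set E → Prop
  | 0, _, _, _, _, f, U => ContinuousOn f U
  | k + 1, _, _, _, _, f, U => ContinuousOn f U ∧
      (∀ x ∈ U, ∀ h, HasDirDerivAt f x h (dirDeriv f (x, h))) ∧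
      ContDirDiffOn k (dirDeriv f) (U ×ˢ univ)

theorem ContDirDiffOn.continuousOn {k : ℕ} {E : Type u} [AddCommGroup E] [Module ℝ E]
    [TopologicalSpace E] {f : E → F} {U : Set E} (hf : ContDirDiffOn k f U) : ContinuousOn f U := by
  cases k with
  | zero => exact hf
  | succ k => exact hf.1

theorem ContDirDiffOn.of_succ {k : ℕ} {E : Type u} [AddCommGroup E] [Module ℝ E]
    [TopologicalSpace E] {f : E → F} {U : Set E} (hf : ContDirDiffOn (k + 1) f U) :
    ContDirDiffOn k f U := by
  induction k generalizing E with
  | zero => exact hf.1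
  | succ k ih => exact ⟨hf.1, hf.2.1, ih hf.2.2⟩

theorem ContDirDiffOn.mono {k : ℕ} {E : Type u} [AddCommGroup E] [Module ℝ E]
    [TopologicalSpace E] {f : E → F} {U V : Set E} (hf : ContDirDiffOn k f U) (hV : V ⊆ U) :
    ContDirDiffOn k f V := by
  induction k generalizing E with
  | zero => exact ContinuousOn.mono hf hV
  | succ k ih =>
    exact ⟨hf.1.mono hV, fun x hx => hf.2.1 x (hV hx), ih hf.2.2 (prod_mono hV le_rfl)⟩

theorem contDirDiffOn_of_locally {k : ℕ} {E : Type u} [AddCommGroup E] [Module ℝ E]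
    [TopologicalSpace E] {f : E → F} {U : Set E}
    (h : ∀ x ∈ U, ∃ W, IsOpen W ∧ x ∈ W ∧ ContDirDiffOn k f (U ∩ W)) : ContDirDiffOn k f U := by
  have hcont : ContinuousOn f U := continuousOn_of_locally_continuousOn fun x hx => by
    obtain ⟨W, hW, hxW, hf⟩ := h x hx
    exact ⟨W, hW, hxW, hf.continuousOn⟩
  induction k generalizing E with
  | zero => exact hcont
  | succ k ih =>
    have h' : ∀ p ∈ U ×ˢ (univ : Set E), ∃ W, IsOpen W ∧ p ∈ W ∧
        ContDirDiffOn k (dirDeriv f) (U ×ˢ univ ∩ W) := fun p hp => by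
      obtain ⟨W, hW, hxW, hf⟩ := h p.1 hp.1
      refine ⟨W ×ˢ univ, hW.prod isOpen_univ, ⟨hxW, mem_univ _⟩, ?_⟩
      rw [prod_inter_prod, inter_univ]
      exact hf.2.2
    refine ⟨hcont, fun x hx => ?_, ih h' (continuousOn_of_locally_continuousOn fun x hx => ?_)⟩
    · obtain ⟨W, -, hxW, hf⟩ := h x hx
      exact hf.2.1 x ⟨hx, hxW⟩
    · obtain ⟨W, hW, hxW, hf⟩ := h' x hx
      exact ⟨W, hW, hxW, hf.continuousOn⟩

variable [T2Space F]

theorem ContDirDiffOn.congr {k : ℕ} {E : Type u} [AddCommGroup E] [Module ℝ E]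
    [TopologicalSpace E] [IsTopologicalAddGroup E] [ContinuousSMul ℝ E] {f g : E → F} {U : Set E}
    (hU : IsOpen U) (hf : ContDirDiffOn k f U) (hfg : ∀ x ∈ U, g x = f x) :
    ContDirDiffOn k g U := by
  induction k generalizing E with
  | zero => exact ContinuousOn.congr hf hfg
  | succ k ih =>
    have hder : ∀ x ∈ U, ∀ h, HasDirDerivAt g x h (dirDeriv f (x, h)) := fun x hx h =>
      (hf.2.1 x hx h).congr_of_eventuallyEq <| by
        filter_upwards [hU.mem_nhds hx] with y hy using (hfg y hy).symm
    refine ⟨hf.1.congr hfg, fun x hx h => ?_, ih (hU.prod isOpen_univ) hf.2.2 fun p hp => ?_⟩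
    · rw [(hder x hx h).dirDeriv_eq]
      exact hder x hx h
    · exact (hder p.1 hp.1 p.2).dirDeriv_eq

/-- Allows an explicit formula for the derivative in place of `dirDeriv`; limits in `F` being
unique, the two agree on `U ×ˢ univ`. -/
theorem ContDirDiffOn.succ_of_hasDirDerivAt {k : ℕ} {E : Type u} [AddCommGroup E] [Module ℝ E]
    [TopologicalSpace E] [IsTopologicalAddGroup E] [ContinuousSMul ℝ E] {f : E → F} {U : Set E}
    (hU : IsOpen U) (hc : ContinuousOn f U) {d : E × E → F}
    (hd : ∀ x ∈ U, ∀ h, HasDirDerivAt f x h (d (x, h))) (hk : ContDirDiffOn k d (U ×ˢ univ)) :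
    ContDirDiffOn (k + 1) f U := by
  refine ⟨hc, fun x hx h => ?_, hk.congr (hU.prod isOpen_univ) fun p hp =>
    (hd p.1 hp.1 p.2).dirDeriv_eq⟩
  rw [(hd x hx h).dirDeriv_eq]
  exact hd x hx h

theorem ContDirDiffOn.prodMk {F' : Type w} [AddCommGroup F'] [Module ℝ F'] [TopologicalSpace F']
    [T2Space F'] {k : ℕ} {E : Type u} [AddCommGroup E] [Module ℝ E]
    [TopologicalSpace E] [IsTopologicalAddGroup E] [ContinuousSMul ℝ E] {f : E → F} {g : E → F'}
    {U : Set E} (hU : IsOpen U) (hf : ContDirDiffOn k f U) (hg : ContDirDiffOn k g U) :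
    ContDirDiffOn k (fun x => (f x, g x)) U := by
  induction k generalizing E with
  | zero => exact ContinuousOn.prodMk hf hg
  | succ k ih =>
    exact .succ_of_hasDirDerivAt hU (hf.1.prodMk hg.1)
      (fun x hx h => (hf.2.1 x hx h).prodMk (hg.2.1 x hx h))
      (ih (hU.prod isOpen_univ) hf.2.2 hg.2.2)

theorem ContDirDiffOn.comp_linear {k : ℕ} {E : Type u} {E' : Type w} [AddCommGroup E] [Module ℝ E]
    [TopologicalSpace E] [AddCommGroup E'] [Module ℝ E']
    [TopologicalSpace E'] [IsTopologicalAddGroup E'] [ContinuousSMul ℝ E'] {f : E → F} {U : Set E}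
    (hU : IsOpen U) (hf : ContDirDiffOn k f U) {L : E' → E} (hL : IsLinearMap ℝ L)
    (hLc : Continuous L) : ContDirDiffOn k (fun x => f (L x)) (L ⁻¹' U) := by
  induction k generalizing E E' with
  | zero => exact ContinuousOn.comp hf hLc.continuousOn fun _ => id
  | succ k ih =>
    refine .succ_of_hasDirDerivAt (d := fun p => dirDeriv f (L p.1, L p.2)) (hU.preimage hLc)
      (hf.1.comp hLc.continuousOn fun _ => id)
      (fun x hx h => HasDirDerivAt.comp_linearMap (hL.mk' L) (hf.2.1 (L x) hx (L h))) ?_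
    exact (ih (hU.prod isOpen_univ) hf.2.2 (L := fun p : E' × E' => (L p.1, L p.2))
      ⟨fun a b => by simp [hL.map_add], fun c a => by simp [hL.map_smul]⟩
      (by fun_prop)).mono fun p hp => ⟨hp.1, mem_univ _⟩

theorem contDirDiffOn_const {k : ℕ} {E : Type u} [AddCommGroup E] [Module ℝ E]
    [TopologicalSpace E] [IsTopologicalAddGroup E] [ContinuousSMul ℝ E] {U : Set E}
    (hU : IsOpen U) (c : F) : ContDirDiffOn k (fun _ : E => c) U := by
  induction k generalizing E c with
  | zero => exact continuousOn_const
  | succ k ih =>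
    exact .succ_of_hasDirDerivAt hU continuousOn_const (fun x _ h => hasDirDerivAt_const c x h)
      (ih (hU.prod isOpen_univ) 0)

theorem contDirDiffOn_of_isLinearMap {k : ℕ} {E : Type u} [AddCommGroup E] [Module ℝ E]
    [TopologicalSpace E] [IsTopologicalAddGroup E] [ContinuousSMul ℝ E] {L : E → F}
    (hL : IsLinearMap ℝ L) (hLc : Continuous L) {U : Set E} (hU : IsOpen U) :
    ContDirDiffOn k L U := by
  induction k generalizing E with
  | zero => exact hLc.continuousOn
  | succ k ih =>
    refine .succ_of_hasDirDerivAt (d := fun p => L p.2) hU hLc.continuousOn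
      (fun x _ h => ?_) (ih (L := fun p : E × E => L p.2)
        ⟨fun a b => by simp [hL.map_add], fun c a => by simp [hL.map_smul]⟩ (by fun_prop)
        (hU.prod isOpen_univ))
    refine Tendsto.congr' ?_ tendsto_const_nhds
    filter_upwards [self_mem_nhdsWithin] with t ht
    rw [hL.map_add, hL.map_smul, add_sub_cancel_left, smul_smul, inv_mul_cancel₀ ht, one_smul]

variable [IsTopologicalAddGroup F]

theorem ContDirDiffOn.add {k : ℕ} {E : Type u} [AddCommGroup E] [Module ℝ E]
    [TopologicalSpace E] [IsTopologicalAddGroup E] [ContinuousSMul ℝ E] {f g : E → F}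
    {U : Set E} (hU : IsOpen U) (hf : ContDirDiffOn k f U) (hg : ContDirDiffOn k g U) :
    ContDirDiffOn k (fun x => f x + g x) U := by
  induction k generalizing E with
  | zero => exact ContinuousOn.add hf hg
  | succ k ih =>
    exact .succ_of_hasDirDerivAt hU (hf.1.add hg.1)
      (fun x hx h => (hf.2.1 x hx h).add_fun (hg.2.1 x hx h))
      (ih (hU.prod isOpen_univ) hf.2.2 hg.2.2)

theorem ContDirDiffOn.sum {ι : Type*} (s : Finset ι) {k : ℕ} {E : Type u} [AddCommGroup E]
    [Module ℝ E] [TopologicalSpace E] [IsTopologicalAddGroup E] [ContinuousSMul ℝ E]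
    {f : ι → E → F} {U : Set E} (hU : IsOpen U) (hf : ∀ i ∈ s, ContDirDiffOn k (f i) U) :
    ContDirDiffOn k (fun x => ∑ i ∈ s, f i x) U := by
  classical
  induction s using Finset.induction_on with
  | empty => simpa using contDirDiffOn_const hU 0
  | insert a s ha ih =>
    simp only [Finset.sum_insert ha]
    exact .add hU (hf a (Finset.mem_insert_self a s))
      (ih fun i hi => hf i (Finset.mem_insert_of_mem hi))

variable [ContinuousSMul ℝ F] [LocallyConvexSpace ℝ F]

/-- The chain rule. -/
theorem ContDirDiffOn.comp {k : ℕ} {E : Type u} {E' : Type w} [AddCommGroup E] [Module ℝ E]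
    [TopologicalSpace E] [IsTopologicalAddGroup E] [ContinuousSMul ℝ E] [T2Space E]
    [AddCommGroup E'] [Module ℝ E'] [TopologicalSpace E'] [IsTopologicalAddGroup E']
    [ContinuousSMul ℝ E'] {g : E → F} {f : E' → E} {U : Set E'} {V : Set E} (hU : IsOpen U)
    (hV : IsOpen V) (hg : ContDirDiffOn k g V) (hf : ContDirDiffOn k f U) (hUV : MapsTo f U V) :
    ContDirDiffOn k (fun x => g (f x)) U := by
  induction k generalizing E E' with
  | zero => exact ContinuousOn.comp hg hf hUV
  | succ k ih =>
    -- The derivative of the composite is `dirDeriv g` after the tangent map `(x, h) ↦ (f x,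
    -- dirDeriv f (x, h))`, so the induction hypothesis applies to it.
    refine .succ_of_hasDirDerivAt (d := fun p => dirDeriv g (f p.1, dirDeriv f p)) hU
      (hg.1.comp hf.1 hUV) (fun x hx h => ?_) ?_
    · have hopen : V ×ˢ (univ : Set E) ∈ 𝓝 (f x, dirDeriv f (x, h)) :=
        (hV.prod isOpen_univ).mem_nhds ⟨hUV hx, mem_univ _⟩
      refine (hf.2.1 x hx h).comp ?_ (hg.2.2.continuousOn.continuousAt hopen)
      filter_upwards [hopen] with p hp using hg.2.1 p.1 hp.1 p.2
    · have hU' := hU.prod (isOpen_univ (X := E'))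
      have hfst : ContDirDiffOn k (fun p : E' × E' => f p.1) (U ×ˢ univ) :=
        (hf.of_succ.comp_linear hU (L := fun p : E' × E' => p.1) ⟨fun _ _ => rfl, fun _ _ => rfl⟩
          continuous_fst).mono fun p hp => hp.1
      exact ih hU' (hV.prod isOpen_univ) hg.2.2 (hfst.prodMk hU' hf.2.2)
        fun p hp => ⟨hUV hp.1, mem_univ _⟩

end Basic

/-! ### Equivalence with iterated directional derivatives -/

section Tower

variable {F : Type v} [AddCommGroup F] [Module ℝ F] [TopologicalSpace F]

/-- The iterated directional derivatives `∂_{h_j} ⋯ ∂_{h_1} f`. -/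
noncomputable def iterDirDeriv : (j : ℕ) → {E : Type u} → [AddCommGroup E] → [Module ℝ E] →
    (E → F) → E → (Fin j → E) → F
  | 0, _, _, _, f, x, _ => f x
  | j + 1, _, _, _, f, x, h => iterDirDeriv j (dirDeriv f) (x, h 0) fun i => (h i.succ, 0)

theorem ContDirDiffOn.continuousOn_iterDirDeriv {j : ℕ} {E : Type u} [AddCommGroup E] [Module ℝ E]
    [TopologicalSpace E] {f : E → F} {U : Set E} (hf : ContDirDiffOn j f U) :
    ContinuousOn (fun p : E × (Fin j → E) => iterDirDeriv j f p.1 p.2) (U ×ˢ univ) := by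
  induction j generalizing E with
  | zero => exact ContinuousOn.comp hf continuousOn_fst fun p hp => hp.1
  | succ j ih =>
    refine (ih hf.2.2).comp (f := fun p : E × (Fin (j + 1) → E) =>
      (((p.1, p.2 0), fun i => (p.2 i.succ, 0)) : (E × E) × (Fin j → E × E)))
      (Continuous.continuousOn (by fun_prop)) fun p hp => ⟨⟨hp.1, mem_univ _⟩, mem_univ _⟩

/-- After the first derivative, every further direction has the form `(k, 0)`: the base point moves
while the first direction stays frozen. Removing the first direction therefore commutes with
appending a last one. -/
theorem ContDirDiffOn.hasDirDerivAt_iterDirDeriv {j : ℕ} {E : Type u} [AddCommGroup E] [Module ℝ E]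
    [TopologicalSpace E] {f : E → F} {U : Set E} (hf : ContDirDiffOn (j + 1) f U) {x : E}
    (hx : x ∈ U) (h : Fin j → E) (k : E) :
    HasDirDerivAt (fun y => iterDirDeriv j f y h) x k
      (iterDirDeriv (j + 1) f x (Fin.snoc h k)) := by
  induction j generalizing E with
  | zero => exact hf.2.1 x hx k
  | succ j ih =>
    have h1 := ih hf.2.2 (x := (x, h 0)) ⟨hx, mem_univ _⟩ (fun i => (h i.succ, 0)) (k, 0)
    have h2 : iterDirDeriv (j + 2) f x (Fin.snoc h k) = iterDirDeriv (j + 1) (dirDeriv f) (x, h 0)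
        (Fin.snoc (fun i => (h i.succ, 0)) (k, 0)) := by
      rw [iterDirDeriv]
      congr 1
      funext i
      refine Fin.lastCases ?_ (fun i => ?_) i
      · rw [Fin.succ_last, Fin.snoc_last, Fin.snoc_last]
      · rw [Fin.succ_castSucc, Fin.snoc_castSucc, Fin.snoc_castSucc]
    rw [h2]
    simpa [HasDirDerivAt, iterDirDeriv] using h1

theorem lcSmoothOn_of_contDirDiffOn {E : Type u} [AddCommGroup E] [Module ℝ E]
    [TopologicalSpace E] {f : E → F} {U : Set E} (hf : ∀ k, ContDirDiffOn k f U) :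
    LCSmoothOn f U :=
  ⟨fun j => iterDirDeriv j f, fun _ _ _ => rfl, fun j => (hf j).continuousOn_iterDirDeriv,
    fun j _ hx h k => (hf (j + 1)).hasDirDerivAt_iterDirDeriv hx h k⟩

variable [T2Space F] [IsTopologicalAddGroup F] [ContinuousSMul ℝ F] [LocallyConvexSpace ℝ F]
  {E : Type u} [AddCommGroup E] [Module ℝ E] [TopologicalSpace E] [IsTopologicalAddGroup E]
  [ContinuousSMul ℝ E] {U : Set E} {D : (j : ℕ) → E → (Fin j → E) → F}

/-- Multilinearity of the derivatives is not part of the definition of smoothness. In the last slot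
it is linearity of a continuous directional derivative in its direction; in the earlier slots it
follows by differentiating the linearity of the previous level. -/
theorem map_update_of_hasDirDerivAt (hU : IsOpen U)
    (hc : ∀ j, ContinuousOn (fun p : E × (Fin j → E) => D j p.1 p.2) (U ×ˢ univ))
    (hd : ∀ j, ∀ x ∈ U, ∀ (h : Fin j → E) (k : E),
      HasDirDerivAt (fun y => D j y h) x k (D (j + 1) x (Fin.snoc h k)))
    (j : ℕ) {x : E} (hx : x ∈ U) (h : Fin j → E) (i : Fin j) :
    (∀ y z, D j x (Function.update h i (y + z)) =
      D j x (Function.update h i y) + D j x (Function.update h i z)) ∧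
    ∀ (c : ℝ) y, D j x (Function.update h i (c • y)) = c • D j x (Function.update h i y) := by
  induction j generalizing x with
  | zero => exact i.elim0
  | succ j ih =>
    obtain ⟨h, k, rfl⟩ : ∃ (h' : Fin j → E) (k : E), h = Fin.snoc h' k :=
      ⟨Fin.init h, h (Fin.last j), (Fin.snoc_init_self h).symm⟩
    induction i using Fin.lastCases with
    | last =>
      simp only [Fin.update_snoc_last]
      refine ⟨fun y z => ?_, fun c y => (hd j x hx h (c • y)).unique ((hd j x hx h y).smul_dir c)⟩
      refine (hd j x hx h (y + z)).unique (HasDirDerivAt.add_dir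
        (d := fun x' => D (j + 1) x' (Fin.snoc h z)) (hd j x hx h y) ?_ ?_)
      · filter_upwards [hU.mem_nhds hx] with x' hx' using hd j x' hx' h z
      · exact ((hc (j + 1)).comp (f := fun x' => (x', (Fin.snoc h z : Fin (j + 1) → E)))
          (Continuous.continuousOn (by fun_prop))
          (fun x' hx' => ⟨hx', mem_univ _⟩)).continuousAt (hU.mem_nhds hx)
    | cast i =>
      simp only [← Fin.snoc_update]
      refine ⟨fun y z => ?_, fun c y => ?_⟩
      · refine (hd j x hx _ k).unique (((hd j x hx _ k).add_fun
          (hd j x hx _ k)).congr_of_eventuallyEq ?_)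
        filter_upwards [hU.mem_nhds hx] with x' hx' using ((ih hx' h i).1 y z).symm
      · refine (hd j x hx _ k).unique (((hd j x hx _ k).const_smul_fun c).congr_of_eventuallyEq ?_)
        filter_upwards [hU.mem_nhds hx] with x' hx' using ((ih hx' h i).2 c y).symm

theorem hasDirDerivAt_uncurry (hU : IsOpen U)
    (hc : ∀ j, ContinuousOn (fun p : E × (Fin j → E) => D j p.1 p.2) (U ×ˢ univ))
    (hd : ∀ j, ∀ x ∈ U, ∀ (h : Fin j → E) (k : E),
      HasDirDerivAt (fun y => D j y h) x k (D (j + 1) x (Fin.snoc h k)))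
    (j : ℕ) {x : E} (hx : x ∈ U) (h : Fin j → E) (k : E) (l : Fin j → E) :
    HasDirDerivAt (fun p : E × (Fin j → E) => D j p.1 p.2) (x, h) (k, l)
      (D (j + 1) x (Fin.snoc h k) + ∑ i, D j x (Function.update h i (l i))) := by
  -- The slots of `l` are added to the direction one at a time, since `add_dir` requires control
  -- near the point only of the newly added partial derivative.
  have key : ∀ s : Finset (Fin j), HasDirDerivAt (fun p : E × (Fin j → E) => D j p.1 p.2)
      (x, h) (k, ∑ i ∈ s, Pi.single i (l i))
      (D (j + 1) x (Fin.snoc h k) + ∑ i ∈ s, D j x (Function.update h i (l i))) := by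
    intro s
    induction s using Finset.induction_on with
    | empty => simpa [HasDirDerivAt] using hd j x hx h k
    | insert a s ha ih =>
      have hopen : U ×ˢ (univ : Set (Fin j → E)) ∈ 𝓝 (x, h) :=
        (hU.prod isOpen_univ).mem_nhds ⟨hx, mem_univ _⟩
      have h1 := ih.add_dir (k := (0, Pi.single a (l a)))
        (d := fun p => D j p.1 (Function.update p.2 a (l a))) ?_ ?_
      · rw [Finset.sum_insert ha, Finset.sum_insert ha, add_comm (Pi.single (M := fun _ => E) a (l a)),
          add_comm (D j x (Function.update h a (l a))), ← add_assoc]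
        simpa using h1
      · filter_upwards [hopen] with p hp
        refine Tendsto.congr' ?_ tendsto_const_nhds
        filter_upwards [self_mem_nhdsWithin] with t ht
        have h2 : p.2 + t • (Pi.single a (l a) : Fin j → E) = Function.update p.2 a (p.2 a + t • l a) := by
          funext i
          rcases eq_or_ne i a with rfl | hi
          · simp
          · simp [hi]
        have h3 := map_update_of_hasDirDerivAt hU hc hd j hp.1 p.2 a
        simp only [Prod.fst_add, Prod.snd_add, Prod.smul_fst, Prod.smul_snd, smul_zero, add_zero]
        rw [h2, h3.1, h3.2, Function.update_eq_self, add_sub_cancel_left, smul_smul,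
          inv_mul_cancel₀ ht, one_smul]
      · exact ((hc j).comp (f := fun p : E × (Fin j → E) => (p.1, Function.update p.2 a (l a)))
          (Continuous.continuousOn (by fun_prop))
          (fun p hp => ⟨hp.1, mem_univ _⟩)).continuousAt hopen
  have := key Finset.univ
  rwa [Finset.univ_sum_single] at this

/-- The total derivative of level `j` is a sum of levels `j + 1` and `j` precomposed with continuous
linear maps, so induction on `k` closes when it is run for all `j` simultaneously. -/
theorem contDirDiffOn_uncurry (hU : IsOpen U)
    (hc : ∀ j, ContinuousOn (fun p : E × (Fin j → E) => D j p.1 p.2) (U ×ˢ univ))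
    (hd : ∀ j, ∀ x ∈ U, ∀ (h : Fin j → E) (k : E),
      HasDirDerivAt (fun y => D j y h) x k (D (j + 1) x (Fin.snoc h k))) (k j : ℕ) :
    ContDirDiffOn k (fun p : E × (Fin j → E) => D j p.1 p.2) (U ×ˢ univ) := by
  induction k generalizing j with
  | zero => exact hc j
  | succ k ih =>
    have hU' := (hU.prod (isOpen_univ (X := Fin j → E))).prod (isOpen_univ (X := E × (Fin j → E)))
    refine .succ_of_hasDirDerivAt (d := fun q => D (j + 1) q.1.1 (Fin.snoc q.1.2 q.2.1) +
      ∑ i, D j q.1.1 (Function.update q.1.2 i (q.2.2 i))) (hU.prod isOpen_univ) (hc j)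
      (fun p hp q => hasDirDerivAt_uncurry hU hc hd j hp.1 p.2 q.1 q.2)
      (.add hU' ?_ (.sum _ hU' fun i _ => ?_))
    · refine ((ih (j + 1)).comp_linear (hU.prod isOpen_univ)
        (L := fun q : (E × (Fin j → E)) × (E × (Fin j → E)) =>
          (q.1.1, (Fin.snoc q.1.2 q.2.1 : Fin (j + 1) → E))) ⟨fun a b => ?_, fun c a => ?_⟩
        (by fun_prop)).mono fun q hq => ⟨hq.1.1, mem_univ _⟩
      · refine Prod.ext rfl (funext fun i => ?_)
        induction i using Fin.lastCases <;> simp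
      · refine Prod.ext rfl (funext fun i => ?_)
        induction i using Fin.lastCases <;> simp
    · refine ((ih j).comp_linear (hU.prod isOpen_univ)
        (L := fun q : (E × (Fin j → E)) × (E × (Fin j → E)) =>
          (q.1.1, Function.update q.1.2 i (q.2.2 i))) ⟨fun a b => ?_, fun c a => ?_⟩
        (by fun_prop)).mono fun q hq => ⟨hq.1.1, mem_univ _⟩
      · refine Prod.ext rfl (funext fun i' => ?_)
        rcases eq_or_ne i' i with rfl | hi
        · simp
        · simp [hi]
      · refine Prod.ext rfl (funext fun i' => ?_)
        rcases eq_or_ne i' i with rfl | hi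
        · simp
        · simp [hi]

theorem LCSmoothOn.contDirDiffOn {f : E → F} (hU : IsOpen U) (hf : LCSmoothOn f U) (k : ℕ) :
    ContDirDiffOn k f U := by
  obtain ⟨D, h0, hc, hd⟩ := hf
  refine (((contDirDiffOn_uncurry hU hc hd k 0).comp_linear (hU.prod isOpen_univ)
    (L := fun x : E => (x, (0 : Fin 0 → E))) ⟨fun a b => by simp, fun c a => by simp⟩
    (by fun_prop)).mono (V := U) fun x hx => ⟨hx, mem_univ _⟩).congr hU fun x hx => (h0 x hx _).symm

end Tower

end ContDirDiff

/-! ### Closure properties of smooth maps on open sets -/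

section SmoothOn

variable {E : Type*} [AddCommGroup E] [Module ℝ E] [TopologicalSpace E]
  {F : Type*} [AddCommGroup F] [Module ℝ F] [TopologicalSpace F]
  {F' : Type*} [AddCommGroup F'] [Module ℝ F'] [TopologicalSpace F'] {U V : Set E}

theorem LCSmoothOn.mono {f : E → F} (hf : LCSmoothOn f U) (hV : V ⊆ U) : LCSmoothOn f V := by
  obtain ⟨D, h0, hc, hd⟩ := hf
  exact ⟨D, fun x hx => h0 x (hV hx), fun j => (hc j).mono (prod_mono hV le_rfl),
    fun j x hx => hd j x (hV hx)⟩

theorem LCSmoothOn.congr {f g : E → F} (hf : LCSmoothOn f U) (hfg : ∀ x ∈ U, g x = f x) :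
    LCSmoothOn g U := by
  obtain ⟨D, h0, hc, hd⟩ := hf
  exact ⟨D, fun x hx h => (h0 x hx h).trans (hfg x hx).symm, hc, hd⟩

theorem LCSmoothOn.prodMk {f : E → F} {g : E → F'} (hf : LCSmoothOn f U) (hg : LCSmoothOn g U) :
    LCSmoothOn (fun x => (f x, g x)) U := by
  obtain ⟨D, h0, hc, hd⟩ := hf
  obtain ⟨D', h0', hc', hd'⟩ := hg
  exact ⟨fun j x h => (D j x h, D' j x h), fun x hx h => Prod.ext (h0 x hx h) (h0' x hx h),
    fun j => (hc j).prodMk (hc' j), fun j x hx h k => (hd j x hx h k).prodMk (hd' j x hx h k)⟩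

variable [IsTopologicalAddGroup E] [ContinuousSMul ℝ E] [T2Space F]

theorem LCSmoothOn.of_isLinearMap {L : E → F} (hL : IsLinearMap ℝ L) (hLc : Continuous L)
    (hU : IsOpen U) : LCSmoothOn L U :=
  lcSmoothOn_of_contDirDiffOn fun _ => contDirDiffOn_of_isLinearMap hL hLc hU

variable [IsTopologicalAddGroup F] [ContinuousSMul ℝ F] [LocallyConvexSpace ℝ F]

theorem LCSmoothOn.continuousOn {f : E → F} (hU : IsOpen U) (hf : LCSmoothOn f U) :
    ContinuousOn f U :=
  hf.contDirDiffOn hU 0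

theorem LCSmoothOn.of_locally {f : E → F} (hU : IsOpen U)
    (h : ∀ x ∈ U, ∃ W, IsOpen W ∧ x ∈ W ∧ LCSmoothOn f (U ∩ W)) : LCSmoothOn f U :=
  lcSmoothOn_of_contDirDiffOn fun k => contDirDiffOn_of_locally fun x hx => by
    obtain ⟨W, hW, hxW, hf⟩ := h x hx
    exact ⟨W, hW, hxW, hf.contDirDiffOn (hU.inter hW) k⟩

theorem LCSmoothOn.add {f g : E → F} (hU : IsOpen U) (hf : LCSmoothOn f U) (hg : LCSmoothOn g U) :
    LCSmoothOn (fun x => f x + g x) U :=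
  lcSmoothOn_of_contDirDiffOn fun k => (hf.contDirDiffOn hU k).add hU (hg.contDirDiffOn hU k)

variable [IsTopologicalAddGroup F'] [ContinuousSMul ℝ F'] [LocallyConvexSpace ℝ F'] [T2Space F']

theorem LCSmoothOn.comp {g : F → F'} {f : E → F} {W : Set F} (hU : IsOpen U)
    (hW : IsOpen W) (hg : LCSmoothOn g W) (hf : LCSmoothOn f U) (hUW : MapsTo f U W) :
    LCSmoothOn (fun x => g (f x)) U :=
  lcSmoothOn_of_contDirDiffOn fun k =>
    (hg.contDirDiffOn hW k).comp hU hW (hf.contDirDiffOn hU k) hUW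

end SmoothOn

/-! ### Smooth maps between manifolds -/

section Manifolds

variable {E : Type*} [AddCommGroup E] [Module ℝ E] [TopologicalSpace E] [IsTopologicalAddGroup E]
  [ContinuousSMul ℝ E] [LocallyConvexSpace ℝ E] [T2Space E]
  {F : Type*} [AddCommGroup F] [Module ℝ F] [TopologicalSpace F] [IsTopologicalAddGroup F]
  [ContinuousSMul ℝ F] [LocallyConvexSpace ℝ F] [T2Space F]
  {K : Type*} [AddCommGroup K] [Module ℝ K] [TopologicalSpace K] [IsTopologicalAddGroup K]
  [ContinuousSMul ℝ K] [LocallyConvexSpace ℝ K] [T2Space K]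
  {M : Type*} [TopologicalSpace M] [ChartedSpace E M]
  {N : Type*} [TopologicalSpace N] [ChartedSpace F N]
  {P : Type*} [TopologicalSpace P] [ChartedSpace K P]

theorem IsLCSmooth.comp {g : N → P} {f : M → N} (hg : IsLCSmooth F K g) (hf : IsLCSmooth E F f) :
    IsLCSmooth E K (fun x => g (f x)) := by
  refine ⟨hg.1.comp hf.1, fun e he e'' he'' => ?_⟩
  have hopen : ∀ {s : Set M}, IsOpen s → IsOpen (e.target ∩ e.symm ⁻¹' s) :=
    fun hs => e.isOpen_inter_preimage_symm hs
  have hU := hopen (e''.open_source.preimage (hg.1.comp hf.1))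
  refine .of_locally hU fun x hx => ?_
  -- Near `x` the composite in charts factors through a chart of `N` around the image point; the
  -- pieces are glued because smoothness is local.
  set e' := chartAt F (f (e.symm x)) with he'
  have hW := hopen (e'.open_source.preimage hf.1)
  refine ⟨_, hW, ⟨hx.1, mem_chart_source F (f (e.symm x))⟩, ?_⟩
  have hgf := LCSmoothOn.comp (hU.inter hW)
    (e'.isOpen_inter_preimage_symm (e''.open_source.preimage hg.1))
    (hg.2 e' (chart_mem_atlas F _) e'' he'')
    ((hf.2 e he e' (chart_mem_atlas F _)).mono inter_subset_right) fun y hy => by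
      refine ⟨e'.map_source hy.2.2, ?_⟩
      have h1 := hy.1.2
      have h2 := e'.left_inv hy.2.2
      simp only [mem_preimage] at h1 ⊢
      rwa [h2]
  exact hgf.congr fun y hy => by rw [e'.left_inv hy.2.2]

theorem hasSmoothAtlas_self : HasSmoothAtlas E E := by
  intro e he e' he'
  rw [chartedSpaceSelf_atlas] at he he'
  subst he he'
  exact LCSmoothOn.of_isLinearMap ⟨fun _ _ => rfl, fun _ _ => rfl⟩ continuous_id (by simp)

theorem isLCSmooth_self_iff {f : E → F} : IsLCSmooth E F f ↔ LCSmoothOn f univ := by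
  refine ⟨fun h => ?_, fun h => ⟨?_, fun e he e' he' => ?_⟩⟩
  · simpa [chartAt_self_eq] using
      h.2 _ (chart_mem_atlas E (0 : E)) _ (chart_mem_atlas F (0 : F))
  · exact continuousOn_univ.1 (h.continuousOn isOpen_univ)
  · rw [chartedSpaceSelf_atlas] at he he'
    subst he he'
    simpa using h

theorem isLCSmooth_iff_of_model {f : M → F} : IsLCSmooth E F f ↔
    Continuous f ∧ ∀ e ∈ atlas E M, LCSmoothOn (fun x => f (e.symm x)) e.target := by
  refine and_congr_right fun _ => ⟨fun h e he => ?_, fun h e he e' he' => ?_⟩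
  · simpa [chartAt_self_eq] using h e he _ (chart_mem_atlas F (0 : F))
  · rw [chartedSpaceSelf_atlas] at he'
    subst he'
    simpa using h e he

theorem IsLCSmooth.add {f g : M → F} (hf : IsLCSmooth E F f) (hg : IsLCSmooth E F g) :
    IsLCSmooth E F (fun x => f x + g x) := by
  rw [isLCSmooth_iff_of_model] at *
  exact ⟨hf.1.add hg.1, fun e he => (hf.2 e he).add e.open_target (hg.2 e he)⟩

section Products

attribute [local instance] lcProdChartedSpace

theorem HasSmoothAtlas.prod (hM : HasSmoothAtlas E M) (hN : HasSmoothAtlas F N) :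
    HasSmoothAtlas (E × F) (M × N) := by
  rintro _ ⟨e₁, he₁, e₂, he₂, rfl⟩ _ ⟨e₁', he₁', e₂', he₂', rfl⟩
  have h₁ := e₁.isOpen_inter_preimage_symm e₁'.open_source
  have h₂ := e₂.isOpen_inter_preimage_symm e₂'.open_source
  have hU := h₁.prod h₂
  refine (LCSmoothOn.prodMk
    (LCSmoothOn.comp hU h₁ (hM e₁ he₁ e₁' he₁') (.of_isLinearMap (L := Prod.fst)
      ⟨fun _ _ => rfl, fun _ _ => rfl⟩ continuous_fst hU) fun p hp => hp.1)
    (LCSmoothOn.comp hU h₂ (hN e₂ he₂ e₂' he₂') (.of_isLinearMap (L := Prod.snd)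
      ⟨fun _ _ => rfl, fun _ _ => rfl⟩ continuous_snd hU) fun p hp => hp.2)).mono ?_
  exact fun p hp => ⟨⟨hp.1.1, hp.2.1⟩, hp.1.2, hp.2.2⟩

theorem isLCSmooth_fst (hM : HasSmoothAtlas E M) :
    IsLCSmooth (E × F) E (Prod.fst : M × N → M) := by
  refine ⟨continuous_fst, ?_⟩
  rintro _ ⟨e₁, he₁, e₂, he₂, rfl⟩ e' he'
  have h₁ := e₁.isOpen_inter_preimage_symm e'.open_source
  have hU := h₁.prod e₂.open_target
  refine (LCSmoothOn.comp hU h₁ (hM e₁ he₁ e' he') (.of_isLinearMap (L := Prod.fst)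
      ⟨fun _ _ => rfl, fun _ _ => rfl⟩ continuous_fst hU) fun p hp => hp.1).mono ?_
  exact fun p hp => ⟨⟨hp.1.1, hp.2⟩, hp.1.2⟩

theorem isLCSmooth_snd (hN : HasSmoothAtlas F N) :
    IsLCSmooth (E × F) F (Prod.snd : M × N → N) := by
  refine ⟨continuous_snd, ?_⟩
  rintro _ ⟨e₁, he₁, e₂, he₂, rfl⟩ e' he'
  have h₂ := e₂.isOpen_inter_preimage_symm e'.open_source
  have hU := e₁.open_target.prod h₂
  refine (LCSmoothOn.comp hU h₂ (hN e₂ he₂ e' he') (.of_isLinearMap (L := Prod.snd)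
      ⟨fun _ _ => rfl, fun _ _ => rfl⟩ continuous_snd hU) fun p hp => hp.2).mono ?_
  exact fun p hp => ⟨hp.1.1, hp.1.2, hp.2⟩

theorem IsLCSmooth.prodMk {f : M → N} {g : M → P} (hf : IsLCSmooth E F f)
    (hg : IsLCSmooth E K g) : IsLCSmooth E (F × K) (fun x => (f x, g x)) := by
  refine ⟨hf.1.prodMk hg.1, ?_⟩
  rintro e he _ ⟨e₁, he₁, e₂, he₂, rfl⟩
  exact LCSmoothOn.prodMk ((hf.2 e he e₁ he₁).mono fun x hx => ⟨hx.1, hx.2.1⟩)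
    ((hg.2 e he e₂ he₂).mono fun x hx => ⟨hx.1, hx.2.2⟩)

end Products

end Manifolds

/-! ### The semidirect product as a Lie group -/

section SemidirectLieGroup

variable {E : Type*} [AddCommGroup E] [Module ℝ E] [TopologicalSpace E] [IsTopologicalAddGroup E]
  [ContinuousSMul ℝ E] [LocallyConvexSpace ℝ E] [T2Space E]
  {G : Type*} [Group G] [TopologicalSpace G] [ChartedSpace E G]
  {V : Type*} [AddCommGroup V] [Module ℝ V] [TopologicalSpace V] [IsTopologicalAddGroup V]
  [ContinuousSMul ℝ V] [LocallyConvexSpace ℝ V] [T2Space V]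
  {α : G →* (V ≃L[ℝ] V)}

attribute [local instance] lcProdChartedSpace

namespace VecSemidirect

theorem hasSmoothAtlas (hG : HasSmoothAtlas E G) : HasSmoothAtlas (V × E) (VecSemidirect α) := by
  have hVG : HasSmoothAtlas (V × E) (V × G) := hasSmoothAtlas_self.prod hG
  rintro _ ⟨e, he, rfl⟩ _ ⟨e', he', rfl⟩
  -- The charts are those of `V × G` transported by `homeoProd`, so the chart changes are
  -- definitionally the same.
  exact hVG e he e' he'

theorem isLCSmooth_homeoProd (hG : HasSmoothAtlas E G) :
    IsLCSmooth (V × E) (V × E) (homeoProd α) := by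
  have hVG : HasSmoothAtlas (V × E) (V × G) := hasSmoothAtlas_self.prod hG
  refine ⟨(homeoProd α).continuous, ?_⟩
  rintro e he _ ⟨e', he', rfl⟩
  exact hVG e he e' he'

theorem isLCSmooth_homeoProd_symm (hG : HasSmoothAtlas E G) :
    IsLCSmooth (V × E) (V × E) (homeoProd α).symm := by
  have hVG : HasSmoothAtlas (V × E) (V × G) := hasSmoothAtlas_self.prod hG
  refine ⟨(homeoProd α).symm.continuous, ?_⟩
  rintro _ ⟨e, he, rfl⟩ e' he'
  exact hVG e he e' he'

theorem homeoProd_mul (v w : V) (g h : G) :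
    homeoProd α (v, g) * homeoProd α (w, h) = homeoProd α (v + α g w, g * h) :=
  ofProd_mul α v w g h

theorem homeoProd_one : homeoProd α (0, 1) = 1 := rfl

theorem act_mul (g h : G) (v : V) : α (g * h) v = α g (α h v) := by
  rw [map_mul]; rfl

theorem act_one (v : V) : α 1 v = v := by
  rw [map_one]; rfl

theorem homeoProd_inv (v : V) (g : G) :
    (homeoProd α (v, g))⁻¹ = homeoProd α (-α g⁻¹ v, g⁻¹) := by
  refine inv_eq_of_mul_eq_one_right ?_
  rw [homeoProd_mul, ← homeoProd_one, mul_inv_cancel, map_neg, ← act_mul, mul_inv_cancel, act_one,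
    add_neg_cancel]

/-- The semidirect product of a Lie group by a smooth linear action is a Lie group. -/
theorem isLCLieGroup (hG : IsLCLieGroup E G) (hα : IsSmoothAction E α) :
    IsLCLieGroup (V × E) (VecSemidirect α) := by
  have hVV : HasSmoothAtlas V V := hasSmoothAtlas_self
  have hA := hG.hasSmoothAtlas
  have hH : HasSmoothAtlas (V × E) (VecSemidirect α) := hasSmoothAtlas hA
  have hs := isLCSmooth_homeoProd_symm (V := V) (α := α) hA
  have hv : IsLCSmooth (V × E) V (fun a : VecSemidirect α => ((homeoProd α).symm a).1) :=
    (isLCSmooth_fst hVV).comp hs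
  have hg : IsLCSmooth (V × E) E (fun a : VecSemidirect α => ((homeoProd α).symm a).2) :=
    (isLCSmooth_snd hA).comp hs
  have hact : IsLCSmooth (E × V) V (fun p : G × V => α p.1 p.2) := hα
  refine ⟨?_, hH, ?_, ?_⟩
  · have := hG.t2Space
    exact (homeoProd α).t2Space
  · have h1 := isLCSmooth_fst (F := V × E) (N := VecSemidirect α) hH
    have h2 := isLCSmooth_snd (E := V × E) (M := VecSemidirect α) hH
    have hmul := (isLCSmooth_homeoProd (α := α) hA).comp
      (((hv.comp h1).add (hact.comp ((hg.comp h1).prodMk (hv.comp h2)))).prodMk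
        (hG.smooth_mul.comp ((hg.comp h1).prodMk (hg.comp h2))))
    convert hmul using 2 with p
    rw [← homeoProd_mul]
    simp
  · have hneg : IsLCSmooth V V (fun v : V => -v) := isLCSmooth_self_iff.2
      (.of_isLinearMap ⟨neg_add, fun c x => (smul_neg c x).symm⟩ continuous_neg isOpen_univ)
    have hinv := (isLCSmooth_homeoProd (α := α) hA).comp
      ((hneg.comp (hact.comp ((hG.smooth_inv.comp hg).prodMk hv))).prodMk (hG.smooth_inv.comp hg))
    convert hinv using 2 with p
    rw [← homeoProd_inv]
    simp

end VecSemidirect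

end SemidirectLieGroup

/-! ### Riemann integration over the unit interval in a complete space -/

section UnitIntegral

/-- The left Riemann sum of `f` over `[0, 1]` with `n` intervals of equal length. -/
noncomputable def riemannSum {V : Type*} [AddCommGroup V] [Module ℝ V] (f : ℝ → V) (n : ℕ) : V :=
  (n : ℝ)⁻¹ • ∑ k ∈ Finset.range n, f (k / n)

/-- The Riemann integral of `f` over `[0, 1]` (a junk value if the Riemann sums diverge). -/
noncomputable def unitIntegral {V : Type*} [AddCommGroup V] [Module ℝ V] [TopologicalSpace V]
    (f : ℝ → V) : V :=
  limUnder atTop (riemannSum f)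

theorem natCast_div_mem_Icc {k n : ℕ} (hk : k < n) : (k / n : ℝ) ∈ Icc (0 : ℝ) 1 :=
  ⟨by positivity, div_le_one_of_le₀ (by exact_mod_cast hk.le) (by positivity)⟩

section Sums

variable {V : Type*} [AddCommGroup V] [Module ℝ V]

theorem riemannSum_sub (f g : ℝ → V) (n : ℕ) :
    riemannSum (fun s => f s - g s) n = riemannSum f n - riemannSum g n := by
  simp [riemannSum, smul_sub]

theorem map_riemannSum {W : Type*} [AddCommGroup W] [Module ℝ W] (L : V →ₗ[ℝ] W) (f : ℝ → V)
    (n : ℕ) : L (riemannSum f n) = riemannSum (fun s => L (f s)) n := by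
  simp [riemannSum]

theorem riemannSum_const (c : V) {n : ℕ} (hn : n ≠ 0) : riemannSum (fun _ => c) n = c := by
  rw [riemannSum, Finset.sum_const, Finset.card_range, ← Nat.cast_smul_eq_nsmul ℝ, smul_smul,
    inv_mul_cancel₀ (by exact_mod_cast hn), one_smul]

theorem Convex.riemannSum_mem {C : Set V} (hC : Convex ℝ C) {f : ℝ → V} {n : ℕ} (hn : n ≠ 0)
    (hf : ∀ k < n, f (k / n) ∈ C) : riemannSum f n ∈ C := by
  rw [riemannSum, Finset.smul_sum]
  refine hC.sum_mem (fun _ _ => by positivity) ?_ fun k hk => hf k (Finset.mem_range.1 hk)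
  simp [hn]

theorem sum_range_mul_eq {M : Type*} [AddCommMonoid M] (f : ℕ → M) (n m : ℕ) :
    ∑ i ∈ Finset.range (n * m), f i =
      ∑ k ∈ Finset.range n, ∑ i ∈ Finset.range m, f (k * m + i) := by
  induction n with
  | zero => simp
  | succ n ih => rw [Finset.sum_range_succ, ← ih, Nat.succ_mul, Finset.sum_range_add]

/-- Cutting each of the `n` intervals into `m` pieces exhibits the difference as an average of `n *
m` differences of values at points at most `1 / n` apart. -/
theorem Convex.riemannSum_sub_mem {C : Set V} (hC : Convex ℝ C) {f : ℝ → V} {n m : ℕ}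
    (hn : n ≠ 0) (hm : m ≠ 0)
    (hf : ∀ s ∈ Icc (0 : ℝ) 1, ∀ s' ∈ Icc (0 : ℝ) 1, |s - s'| ≤ (n : ℝ)⁻¹ → f s - f s' ∈ C) :
    riemannSum f n - riemannSum f (n * m) ∈ C := by
  have hn' : (n : ℝ) ≠ 0 := by exact_mod_cast hn
  have hm' : (m : ℝ) ≠ 0 := by exact_mod_cast hm
  have h1 : riemannSum f n - riemannSum f (n * m) = ∑ k ∈ Finset.range n, ∑ i ∈ Finset.range m,
      ((n * m : ℕ) : ℝ)⁻¹ • (f (k / n) - f ((k * m + i : ℕ) / (n * m : ℕ))) := by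
    rw [riemannSum, riemannSum, sum_range_mul_eq, Finset.smul_sum, Finset.smul_sum,
      ← Finset.sum_sub_distrib]
    refine Finset.sum_congr rfl fun k _ => ?_
    simp only [smul_sub, Finset.sum_sub_distrib, Finset.sum_const, Finset.card_range,
      Finset.smul_sum]
    congr 1
    rw [← Nat.cast_smul_eq_nsmul ℝ, smul_smul]
    congr 1
    push_cast
    field_simp
  rw [h1, ← Finset.sum_product']
  refine hC.sum_mem (fun _ _ => by positivity) ?_ ?_
  · rw [Finset.sum_const, Finset.card_product, Finset.card_range, Finset.card_range, nsmul_eq_mul]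
    exact mul_inv_cancel₀ (by exact_mod_cast mul_ne_zero hn hm)
  · rintro ⟨k, i⟩ hki
    obtain ⟨hk, hi⟩ := Finset.mem_product.1 hki
    rw [Finset.mem_range] at hk hi
    have hlt : k * m + i < n * m := by nlinarith
    refine hf _ (natCast_div_mem_Icc hk) _ (natCast_div_mem_Icc hlt) ?_
    have h2 : (k / n - (k * m + i : ℕ) / (n * m : ℕ) : ℝ) = -(i / m) * (n : ℝ)⁻¹ := by
      push_cast
      field_simp
      ring
    have h3 := (natCast_div_mem_Icc hi).2
    rw [h2, abs_mul, abs_neg, abs_of_nonneg (by positivity : (0 : ℝ) ≤ i / m),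
      abs_of_nonneg (by positivity : (0 : ℝ) ≤ (n : ℝ)⁻¹)]
    exact mul_le_of_le_one_left (by positivity) h3

end Sums

/-- Riemann sums of continuous real functions converge to the integral. -/
theorem tendsto_riemannSum_real {g : ℝ → ℝ} (hg : Continuous g) :
    Tendsto (riemannSum g) atTop (𝓝 (∫ s in (0 : ℝ)..1, g s)) := by
  rw [Metric.tendsto_atTop]
  intro ε hε
  obtain ⟨δ, hδ, hgδ⟩ := Metric.uniformContinuousOn_iff.1
    (isCompact_Icc.uniformContinuousOn_of_continuous (hg.continuousOn (s := Icc (0 : ℝ) 1)))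
    (ε / 2) (half_pos hε)
  obtain ⟨N, hN⟩ := exists_nat_gt δ⁻¹
  refine ⟨N + 1, fun n hn => ?_⟩
  have hn0 : (0 : ℝ) < n := by exact_mod_cast (by omega : 0 < n)
  have hnδ : (n : ℝ)⁻¹ < δ := by
    rw [inv_lt_comm₀ hn0 hδ]
    exact hN.trans (by exact_mod_cast hn)
  have hint : ∀ a b : ℝ, IntervalIntegrable g MeasureTheory.volume a b :=
    fun a b => hg.intervalIntegrable a b
  have hsum := intervalIntegral.sum_integral_adjacent_intervals (f := g)
    (μ := MeasureTheory.volume) (a := fun k : ℕ => (k / n : ℝ)) (n := n) fun k _ => hint _ _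
  simp only [Nat.cast_zero, zero_div, div_self hn0.ne'] at hsum
  rw [← hsum, riemannSum, Finset.smul_sum, dist_eq_norm, ← Finset.sum_sub_distrib]
  refine (norm_sum_le_of_le (f := fun k : ℕ => (n : ℝ)⁻¹ • g (k / n) -
    ∫ x in (k / n : ℝ)..((k + 1 : ℕ) / n), g x) _ (n := fun _ => ε / 2 * (n : ℝ)⁻¹)
    fun k hk => ?_).trans_lt ?_
  · rw [Finset.mem_range] at hk
    have hlen : ((k + 1 : ℕ) / n - k / n : ℝ) = (n : ℝ)⁻¹ := by
      push_cast
      field_simp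
      ring
    have hle : (k / n : ℝ) ≤ (k + 1 : ℕ) / n := by
      rw [← sub_nonneg, hlen]
      positivity
    have h1 : (n : ℝ)⁻¹ • g (k / n) = ∫ _ in (k / n : ℝ)..((k + 1 : ℕ) / n), g (k / n) := by
      rw [intervalIntegral.integral_const, hlen]
    rw [h1, ← intervalIntegral.integral_sub intervalIntegrable_const (hint _ _)]
    refine (intervalIntegral.norm_integral_le_of_norm_le_const (C := ε / 2) fun x hx => ?_).trans ?_
    · rw [uIoc_of_le hle] at hx
      have hx1 : x ≤ 1 := hx.2.trans (div_le_one_of_le₀ (by exact_mod_cast hk) hn0.le)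
      have hk0 := natCast_div_mem_Icc hk
      rw [← dist_eq_norm]
      refine (hgδ _ hk0 x ⟨hk0.1.trans hx.1.le, hx1⟩ ?_).le
      rw [dist_comm, Real.dist_eq, abs_of_pos (sub_pos.2 hx.1)]
      linarith [hx.2]
    · rw [hlen, abs_of_pos (inv_pos.2 hn0)]
  · rw [Finset.sum_const, Finset.card_range, nsmul_eq_mul]
    field_simp
    linarith

variable {V : Type*} [AddCommGroup V] [Module ℝ V] [UniformSpace V] [IsUniformAddGroup V]
  [ContinuousSMul ℝ V] [LocallyConvexSpace ℝ V]

/-- The sums for `n` and for `m` are both compared with the sum for the common refinement `n * m`;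
uniform continuity on `[0, 1]` puts each difference in a small convex neighbourhood of `0`. -/
theorem cauchySeq_riemannSum {f : ℝ → V} (hf : Continuous f) : CauchySeq (riemannSum f) := by
  rw [cauchySeq_iff]
  intro R hR
  rw [uniformity_eq_comap_nhds_zero, mem_comap] at hR
  obtain ⟨W, hW, hWR⟩ := hR
  have hsub : Tendsto (fun p : V × V => p.1 - p.2) (𝓝 (0, 0)) (𝓝 0) :=
    continuous_sub.tendsto' _ _ (sub_zero 0)
  rw [nhds_prod_eq] at hsub
  obtain ⟨W₁, hW₁, W₂, hW₂, h12⟩ := mem_prod_iff.1 (hsub hW)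
  obtain ⟨C, hCW, hCo, hC, h0C⟩ := exists_isOpen_convex_subset (inter_mem hW₁ hW₂)
  have huc := isCompact_Icc.uniformContinuousOn_of_continuous
    (hf.continuousOn (s := Icc (0 : ℝ) 1))
  have hCu : {p : V × V | p.1 - p.2 ∈ C} ∈ uniformity V := by
    rw [uniformity_eq_comap_nhds_zero_swapped]
    exact preimage_mem_comap (hCo.mem_nhds h0C)
  rw [uniformContinuousOn_iff_restrict] at huc
  obtain ⟨δ, hδ, hδC⟩ := Metric.mem_uniformity_dist.1 (mem_map.1 (huc hCu))
  obtain ⟨N, hN⟩ := exists_nat_gt δ⁻¹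
  have key : ∀ n, N + 1 ≤ n → ∀ m, m ≠ 0 → riemannSum f n - riemannSum f (n * m) ∈ C := by
    intro n hn m hm
    have hn0 : (0 : ℝ) < n := by exact_mod_cast (by omega : 0 < n)
    refine hC.riemannSum_sub_mem (by omega) hm fun s hs s' hs' hss => ?_
    refine hδC (a := ⟨s, hs⟩) (b := ⟨s', hs'⟩) (hss.trans_lt ?_)
    rw [inv_lt_comm₀ hn0 hδ]
    exact hN.trans (by exact_mod_cast hn)
  refine ⟨N + 1, fun n hn m hm => hWR ?_⟩
  have h1 := key m hm n (by omega)
  have h2 := key n hn m (by omega)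
  rw [mul_comm] at h2
  have h3 := h12 (a := (_, _)) ⟨(hCW h1).1, (hCW h2).2⟩
  simpa using h3

/-- Compactness of `[0, 1]` makes convergence along `𝓝 s ×ˢ l` at every `s` uniform in `s`. The
functions `b · a` may be discontinuous, as the step functions of the Trotter argument are. -/
theorem eventually_forall_Icc_sub_mem {A : Type*} {l : Filter A} {b : ℝ → A → V} {g : ℝ → V}
    (hg : Continuous g)
    (h : ∀ s ∈ Icc (0 : ℝ) 1, Tendsto (fun p : ℝ × A => b p.1 p.2) (𝓝 s ×ˢ l) (𝓝 (g s)))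
    {W : Set V} (hW : W ∈ 𝓝 0) : ∀ᶠ a in l, ∀ s ∈ Icc (0 : ℝ) 1, b s a - g s ∈ W := by
  have h1 : {p : ℝ × A | b p.1 p.2 - g p.1 ∈ W} ∈ 𝓝ˢ (Icc (0 : ℝ) 1) ×ˢ l := by
    refine isCompact_Icc.mem_nhdsSet_prod_of_forall fun s hs => ?_
    have h2 := (h s hs).sub ((hg.tendsto s).comp tendsto_fst)
    rw [sub_self] at h2
    exact h2 hW
  obtain ⟨S, hS, T, hT, hST⟩ := mem_prod_iff.1 h1
  filter_upwards [hT] with a ha s hs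
  exact hST (a := (s, a)) ⟨subset_of_mem_nhdsSet hS hs, ha⟩

variable [T2Space V] [CompleteSpace V]

theorem tendsto_riemannSum {f : ℝ → V} (hf : Continuous f) :
    Tendsto (riemannSum f) atTop (𝓝 (unitIntegral f)) :=
  (cauchySeq_riemannSum hf).tendsto_limUnder

theorem unitIntegral_eq_of_tendsto {f : ℝ → V} {y : V} (h : Tendsto (riemannSum f) atTop (𝓝 y)) :
    unitIntegral f = y :=
  h.limUnder_eq

theorem unitIntegral_sub {f g : ℝ → V} (hf : Continuous f) (hg : Continuous g) :
    unitIntegral (fun s => f s - g s) = unitIntegral f - unitIntegral g :=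
  unitIntegral_eq_of_tendsto <| ((tendsto_riemannSum hf).sub (tendsto_riemannSum hg)).congr
    fun n => (riemannSum_sub f g n).symm

theorem unitIntegral_const (c : V) : unitIntegral (fun _ => c) = c :=
  unitIntegral_eq_of_tendsto <| tendsto_const_nhds.congr' <| by
    filter_upwards [eventually_ne_atTop 0] with n hn using (riemannSum_const c hn).symm

theorem map_unitIntegral (L : V →L[ℝ] V) {f : ℝ → V} (hf : Continuous f) :
    L (unitIntegral f) = unitIntegral fun s => L (f s) :=
  (unitIntegral_eq_of_tendsto <| ((L.continuous.tendsto _).comp (tendsto_riemannSum hf)).congr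
    fun n => map_riemannSum (L : V →ₗ[ℝ] V) f n).symm

theorem unitIntegral_smul (c : ℝ) {f : ℝ → V} (hf : Continuous f) :
    unitIntegral (fun s => c • f s) = c • unitIntegral f :=
  (map_unitIntegral (c • ContinuousLinearMap.id ℝ V) hf).symm

theorem dual_unitIntegral (L : V →L[ℝ] ℝ) {f : ℝ → V} (hf : Continuous f) :
    L (unitIntegral f) = ∫ s in (0 : ℝ)..1, L (f s) :=
  tendsto_nhds_unique (((L.continuous.tendsto _).comp (tendsto_riemannSum hf)).congr
    fun n => map_riemannSum (L : V →ₗ[ℝ] ℝ) f n) (tendsto_riemannSum_real (by fun_prop))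

/-- The integrand and the number of nodes vary together, and only the limit function must be
continuous. This is the convergence used for the `V`-component of the Trotter products. -/
theorem tendsto_riemannSum_of_locally {A : Type*} {l : Filter A} {b : ℝ → A → V} {g : ℝ → V}
    (hg : Continuous g) {N : A → ℕ} (hN : Tendsto N l atTop)
    (h : ∀ s ∈ Icc (0 : ℝ) 1, Tendsto (fun p : ℝ × A => b p.1 p.2) (𝓝 s ×ˢ l) (𝓝 (g s))) :
    Tendsto (fun a => riemannSum (fun s => b s a) (N a)) l (𝓝 (unitIntegral g)) := by
  have h1 : Tendsto (fun a => riemannSum (fun s => b s a - g s) (N a)) l (𝓝 0) := by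
    intro W hW
    obtain ⟨C, hCW, hCo, hC, h0C⟩ := exists_isOpen_convex_subset hW
    rw [mem_map]
    filter_upwards [eventually_forall_Icc_sub_mem hg h (hCo.mem_nhds h0C),
      hN.eventually_ne_atTop 0] with a ha hNa
    exact hCW (hC.riemannSum_mem hNa fun k hk => ha _ (natCast_div_mem_Icc hk))
  have h2 := h1.add ((tendsto_riemannSum hg).comp hN)
  rw [zero_add] at h2
  exact h2.congr fun a => by simp [riemannSum_sub]

theorem tendsto_unitIntegral_of_locally {A : Type*} {l : Filter A} {b : ℝ → A → V} {g : ℝ → V}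
    (hg : Continuous g) (hb : ∀ a, Continuous fun s => b s a)
    (h : ∀ s ∈ Icc (0 : ℝ) 1, Tendsto (fun p : ℝ × A => b p.1 p.2) (𝓝 s ×ˢ l) (𝓝 (g s))) :
    Tendsto (fun a => unitIntegral fun s => b s a) l (𝓝 (unitIntegral g)) := by
  have h1 : Tendsto (fun a => unitIntegral fun s => b s a - g s) l (𝓝 0) := by
    intro W hW
    -- The integral is only a limit of Riemann sums in `C`, so a closed neighbourhood is needed to
    -- keep it inside `W`.
    obtain ⟨W', hW', hW'c, hW'W⟩ := exists_mem_nhds_isClosed_subset hW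
    obtain ⟨C, hCW, hCo, hC, h0C⟩ := exists_isOpen_convex_subset hW'
    rw [mem_map]
    filter_upwards [eventually_forall_Icc_sub_mem hg h (hCo.mem_nhds h0C)] with a ha
    refine hW'W (hW'c.mem_of_tendsto (tendsto_riemannSum ((hb a).sub hg)) ?_)
    filter_upwards [eventually_ne_atTop 0] with n hn
    exact hCW (hC.riemannSum_mem hn fun k hk => ha _ (natCast_div_mem_Icc hk))
  have h2 := h1.add_const (unitIntegral g)
  rw [zero_add] at h2
  exact h2.congr fun a => by rw [unitIntegral_sub (hb a) hg, sub_add_cancel]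

theorem continuous_unitIntegral {A : Type*} [TopologicalSpace A] {b : ℝ → A → V}
    (hb : Continuous fun p : ℝ × A => b p.1 p.2) : Continuous fun a => unitIntegral fun s => b s a :=
  continuous_iff_continuousAt.2 fun a => tendsto_unitIntegral_of_locally
    (hb.comp (Continuous.prodMk_left a)) (fun a => hb.comp (Continuous.prodMk_left a)) fun s _ => by
      rw [← nhds_prod_eq]
      exact hb.tendsto (s, a)

/-- The substitution rule together with the additivity of the integral in the interval. -/
theorem unitIntegral_smul_comp_add {c : ℝ → V} (hc : Continuous c) (s t : ℝ) :
    unitIntegral (fun σ => (s + t) • c (σ * (s + t))) =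
      unitIntegral (fun σ => s • c (σ * s)) + unitIntegral fun σ => t • c (s + σ * t) := by
  by_contra hne
  -- Continuous functionals separate points, which reduces the identity to integrals of real
  -- functions.
  obtain ⟨L, hL⟩ := geometric_hahn_banach_point_point hne
  have h1 : ∀ a r : ℝ, ∫ σ in (0 : ℝ)..1, L (r • c (a + σ * r)) =
      ∫ τ in a..(a + r), L (c τ) := by
    intro a r
    have h2 := intervalIntegral.mul_integral_comp_mul_add (a := 0) (b := 1)
      (f := fun τ => L (c τ)) r a
    simp only [mul_zero, mul_one, zero_add] at h2
    rw [add_comm a r, ← h2, ← intervalIntegral.integral_const_mul]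
    simp only [map_smul, smul_eq_mul, mul_comm, add_comm]
  have hint : ∀ a b : ℝ, IntervalIntegrable (fun τ => L (c τ)) MeasureTheory.volume a b :=
    fun a b => (L.continuous.comp hc).intervalIntegrable a b
  have h3 := intervalIntegral.integral_add_adjacent_intervals (hint 0 s) (hint s (s + t))
  have h4 := h1 0 s
  have h5 := h1 0 (s + t)
  simp only [zero_add] at h4 h5
  rw [map_add, dual_unitIntegral L (by fun_prop), dual_unitIntegral L (by fun_prop),
    dual_unitIntegral L (by fun_prop), h1, h4, h5, h3] at hL
  exact lt_irrefl _ hL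

/-- Smooth dependence of the integral on a parameter. -/
theorem lcSmoothOn_unitIntegral {P : Type*} [AddCommGroup P] [Module ℝ P] [TopologicalSpace P]
    [IsTopologicalAddGroup P] [ContinuousSMul ℝ P] {f : ℝ × P → V} (hf : LCSmoothOn f univ) :
    LCSmoothOn (fun p => unitIntegral fun s => f (s, p)) univ := by
  obtain ⟨D, h0, hc, hd⟩ := hf
  have hc' : ∀ j, Continuous fun p : (ℝ × P) × (Fin j → ℝ × P) => D j p.1 p.2 := fun j => by
    have := hc j
    rwa [univ_prod_univ, continuousOn_univ] at this
  have hcj : ∀ j, Continuous fun q : ℝ × (P × (Fin j → P)) =>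
      D j (q.1, q.2.1) fun i => (0, q.2.2 i) := fun j =>
    (hc' j).comp (g := fun p : (ℝ × P) × (Fin j → ℝ × P) => D j p.1 p.2)
      (f := fun q : ℝ × (P × (Fin j → P)) => ((q.1, q.2.1), fun i => (0, q.2.2 i))) (by fun_prop)
  have hcs : ∀ j (p : P) (h : Fin j → P), Continuous fun s : ℝ => D j (s, p) fun i => (0, h i) :=
    fun j p h => (hcj j).comp (Continuous.prodMk_left (p, h))
  -- Differentiation under the integral: each direction `h i` in `P` becomes `(0, h i)`, leaving the
  -- integration variable fixed.
  refine ⟨fun j p h => unitIntegral fun s => D j (s, p) fun i => (0, h i), fun p _ h => ?_,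
    fun j => ?_, fun j p _ h k => ?_⟩
  · simp only [h0 _ (mem_univ _)]
  · exact (continuous_unitIntegral (b := fun s (q : P × (Fin j → P)) =>
      D j (s, q.1) fun i => (0, q.2 i)) (hcj j)).continuousOn
  · have hsn : (fun i => ((0 : ℝ), (Fin.snoc h k : Fin (j + 1) → P) i)) =
        (Fin.snoc (fun i => ((0 : ℝ), h i)) (0, k) : Fin (j + 1) → ℝ × P) := by
      funext i
      induction i using Fin.lastCases <;> simp
    have hq : ∀ t : ℝ, Continuous fun s : ℝ =>
        t⁻¹ • (D j (s, p + t • k) (fun i => (0, h i)) - D j (s, p) fun i => (0, h i)) :=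
      fun t => ((hcs j _ h).sub (hcs j _ h)).const_smul _
    refine (tendsto_unitIntegral_of_locally (l := 𝓝[≠] (0 : ℝ)) (hcs (j + 1) p (Fin.snoc h k)) hq
      fun s _ => ?_).congr fun t => ?_
    -- Strict differentiability at `(s, p)` lets the base point vary in `s`, which supplies the
    -- locally uniform convergence of the difference quotients in the integrand.
    · have h1 := tendsto_smul_sub_of_hasDirDerivAt (f := fun q => D j q fun i => (0, h i))
        (x := (s, p)) (l := pure ((0 : ℝ), k)) (pure_le_nhds _)
        (d := fun q r => D (j + 1) q (Fin.snoc (fun i => (0, h i)) r))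
        (w := D (j + 1) (s, p) fun i => (0, (Fin.snoc h k : Fin (j + 1) → P) i))
        (.of_forall fun q => hd j q.1 (mem_univ _) _ q.2) (by
          rw [hsn, prod_pure, tendsto_map'_iff]
          exact ((hc' (j + 1)).comp (Continuous.prodMk_left _)).tendsto (s, p))
      have hx : Tendsto (fun q : ℝ × ℝ => (q.1, p)) (𝓝 s ×ˢ 𝓝[≠] 0) (𝓝 (s, p)) :=
        ((Continuous.prodMk_left p).tendsto s).comp tendsto_fst
      have hk : Tendsto (fun _ : ℝ × ℝ => ((0 : ℝ), k)) (𝓝 s ×ˢ 𝓝[≠] 0) (pure (0, k)) :=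
        tendsto_pure.2 (.of_forall fun _ => rfl)
      refine (h1.comp (hx.prodMk (hk.prodMk tendsto_snd))).congr fun q => ?_
      simp
    · exact (unitIntegral_smul _ ((hcs j _ h).sub (hcs j _ h))).trans
        (congrArg _ (unitIntegral_sub (hcs j _ h) (hcs j _ h)))

end UnitIntegral

/-! ### Smoothness of scalar multiplication -/

section SmoothSMul

variable {E : Type*} [AddCommGroup E] [Module ℝ E] [TopologicalSpace E] [IsTopologicalAddGroup E]
  [ContinuousSMul ℝ E] [T2Space E]

/-- By the product rule the derivative is a sum of two copies of the same map precomposed with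
linear projections, so the induction closes. -/
theorem contDirDiffOn_smul (k : ℕ) :
    ContDirDiffOn k (fun p : ℝ × E => p.1 • p.2) univ := by
  induction k with
  | zero => exact continuous_smul.continuousOn
  | succ k ih =>
    have hU : IsOpen ((univ : Set (ℝ × E)) ×ˢ (univ : Set (ℝ × E))) := isOpen_univ.prod isOpen_univ
    refine .succ_of_hasDirDerivAt (d := fun q => q.1.1 • q.2.2 + q.2.1 • q.1.2) isOpen_univ
      continuous_smul.continuousOn (fun p _ q => ?_) (.add hU ?_ ?_)
    · have h1 : Tendsto (fun t : ℝ => p.1 • q.2 + q.1 • p.2 + t • q.1 • q.2) (𝓝[≠] 0)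
          (𝓝 (p.1 • q.2 + q.1 • p.2)) :=
        ((by fun_prop : Continuous fun t : ℝ => p.1 • q.2 + q.1 • p.2 + t • q.1 • q.2).tendsto'
          0 _ (by simp)).mono_left nhdsWithin_le_nhds
      refine h1.congr' ?_
      filter_upwards [self_mem_nhdsWithin] with t ht
      rw [eq_inv_smul_iff₀ ht]
      simp only [Prod.fst_add, Prod.snd_add, Prod.smul_fst, Prod.smul_snd, smul_eq_mul]
      module
    · exact (ih.comp_linear isOpen_univ (L := fun q : (ℝ × E) × (ℝ × E) => (q.1.1, q.2.2))
        ⟨fun _ _ => rfl, fun _ _ => rfl⟩ (by fun_prop)).mono fun _ _ => mem_univ _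
    · exact (ih.comp_linear isOpen_univ (L := fun q : (ℝ × E) × (ℝ × E) => (q.2.1, q.1.2))
        ⟨fun _ _ => rfl, fun _ _ => rfl⟩ (by fun_prop)).mono fun _ _ => mem_univ _

theorem lcSmoothOn_smul : LCSmoothOn (fun p : ℝ × E => p.1 • p.2) univ :=
  lcSmoothOn_of_contDirDiffOn contDirDiffOn_smul

end SmoothSMul

/-! ### The exponential function of the semidirect product -/

section Exponential

variable {E : Type*} [AddCommGroup E] [Module ℝ E] [TopologicalSpace E] [IsTopologicalAddGroup E]
  [ContinuousSMul ℝ E] [LocallyConvexSpace ℝ E] [T2Space E]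
  {G : Type*} [Group G] [TopologicalSpace G] [ChartedSpace E G]

theorem IsExpFunction.map_zero {ex : E → G} (hex : IsExpFunction E ex) : ex 0 = 1 := by
  have h := hex.map_add_smul 0 0 0
  rw [add_zero, zero_smul] at h
  exact left_eq_mul.1 h

variable {V : Type*} [AddCommGroup V] [Module ℝ V] [UniformSpace V] [IsUniformAddGroup V]
  [ContinuousSMul ℝ V] [LocallyConvexSpace ℝ V] [T2Space V]
  {α : G →* (V ≃L[ℝ] V)} {ex : E → G}

namespace VecSemidirect

theorem continuous_act (hα : IsSmoothAction E α) : Continuous fun p : G × V => α p.1 p.2 :=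
  hα.1

/-- `(v, x) ↦ ∫₀¹ α (ex (s x)) v ds`, the first component of the exponential function of
`V ⋊_α G`. -/
noncomputable def expLeft (α : G →* (V ≃L[ℝ] V)) (ex : E → G) (p : V × E) : V :=
  unitIntegral fun s => α (ex (s • p.2)) p.1

/-- The exponential function of `V ⋊_α G`. -/
noncomputable def expSemidirect (α : G →* (V ≃L[ℝ] V)) (ex : E → G) (p : V × E) :
    VecSemidirect α :=
  homeoProd α (expLeft α ex p, ex p.2)

theorem lcSmoothOn_act_exp (hα : IsSmoothAction E α) (hex : IsExpFunction E ex) :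
    LCSmoothOn (fun q : ℝ × (V × E) => α (ex (q.1 • q.2.2)) q.2.1) univ := by
  have h1 : LCSmoothOn (fun q : ℝ × (V × E) => q.1 • q.2.2) univ :=
    LCSmoothOn.comp isOpen_univ isOpen_univ lcSmoothOn_smul
      (.of_isLinearMap (L := fun q : ℝ × (V × E) => (q.1, q.2.2))
        ⟨fun _ _ => rfl, fun _ _ => rfl⟩ (by fun_prop) isOpen_univ) (mapsTo_univ _ _)
  have h2 : LCSmoothOn (fun q : ℝ × (V × E) => q.2.1) univ :=
    .of_isLinearMap ⟨fun _ _ => rfl, fun _ _ => rfl⟩ (by fun_prop) isOpen_univ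
  let := lcProdChartedSpace E V G V
  have hα' : IsLCSmooth (E × V) V (fun p : G × V => α p.1 p.2) := hα
  exact isLCSmooth_self_iff.1 (hα'.comp
    ((hex.smooth.comp (isLCSmooth_self_iff.2 h1)).prodMk (isLCSmooth_self_iff.2 h2)))

theorem continuous_act_exp (hα : IsSmoothAction E α) (hex : IsExpFunction E ex) :
    Continuous fun q : ℝ × (V × E) => α (ex (q.1 • q.2.2)) q.2.1 :=
  continuousOn_univ.1 ((lcSmoothOn_act_exp hα hex).continuousOn isOpen_univ)

theorem continuous_act_exp_curve (hα : IsSmoothAction E α) (hex : IsExpFunction E ex)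
    (p : V × E) : Continuous fun s : ℝ => α (ex (s • p.2)) p.1 :=
  (continuous_act_exp hα hex).comp (Continuous.prodMk_left p)

variable [CompleteSpace V]

theorem lcSmoothOn_expLeft (hα : IsSmoothAction E α) (hex : IsExpFunction E ex) :
    LCSmoothOn (expLeft α ex) univ :=
  lcSmoothOn_unitIntegral (f := fun q : ℝ × (V × E) => α (ex (q.1 • q.2.2)) q.2.1) (lcSmoothOn_act_exp hα hex)

theorem continuous_expLeft (hα : IsSmoothAction E α) (hex : IsExpFunction E ex) :
    Continuous (expLeft α ex) :=
  continuousOn_univ.1 ((lcSmoothOn_expLeft hα hex).continuousOn isOpen_univ)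

theorem expLeft_smul_fst (hα : IsSmoothAction E α) (hex : IsExpFunction E ex) (r : ℝ) (v : V)
    (x : E) : expLeft α ex (r • v, x) = r • expLeft α ex (v, x) := by
  rw [expLeft, expLeft, ← unitIntegral_smul r (continuous_act_exp_curve hα hex (v, x))]
  simp only [map_smul]

theorem expLeft_zero_snd (hex : IsExpFunction E ex) (v : V) : expLeft α ex (v, 0) = v := by
  simp only [expLeft, smul_zero, hex.map_zero, act_one, unitIntegral_const]

/-- This cocycle identity is the first component of the one-parameter law. By substitution `expLeft
α ex (r • p)` is the integral of `α (ex (τ • p.2)) p.1` over `τ` from `0` to `r`; split at `s` and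
pull `α (ex (s • p.2))` out of the second part. -/
theorem expLeft_add_smul (hα : IsSmoothAction E α) (hex : IsExpFunction E ex) (s t : ℝ)
    (p : V × E) : expLeft α ex ((s + t) • p) =
      expLeft α ex (s • p) + α (ex (s • p.2)) (expLeft α ex (t • p)) := by
  have h := unitIntegral_smul_comp_add (continuous_act_exp_curve hα hex p) s t
  have h1 : ∀ r : ℝ, expLeft α ex (r • p) =
      unitIntegral fun σ => r • α (ex ((σ * r) • p.2)) p.1 := fun r => by
    simp only [expLeft, Prod.smul_fst, Prod.smul_snd, map_smul, smul_smul]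
  have h2 : α (ex (s • p.2)) (expLeft α ex (t • p)) =
      unitIntegral fun σ => t • α (ex ((s + σ * t) • p.2)) p.1 := by
    have h3 := map_unitIntegral (α (ex (s • p.2)) : V →L[ℝ] V)
      (continuous_act_exp_curve hα hex (t • p))
    refine h3.trans (congrArg _ (funext fun σ => ?_))
    simp only [hex.map_add_smul, act_mul, Prod.smul_fst, Prod.smul_snd, map_smul, smul_smul]
    simp
  rw [h1, h1 s, h2]
  exact h

theorem isExpFunction (hG : IsLCLieGroup E G) (hα : IsSmoothAction E α)
    (hex : IsExpFunction E ex) :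
    IsExpFunction (V × E) (expSemidirect α ex) := by
  refine ⟨?_, fun s t p => ?_, fun p => ?_⟩
  · have hsnd : IsLCSmooth (V × E) E (Prod.snd : V × E → E) := isLCSmooth_self_iff.2
      (.of_isLinearMap ⟨fun _ _ => rfl, fun _ _ => rfl⟩ continuous_snd isOpen_univ)
    have h1 := (isLCSmooth_self_iff.2 (lcSmoothOn_expLeft hα hex)).prodMk (hex.smooth.comp hsnd)
    let := lcProdChartedSpace V E V G
    exact (isLCSmooth_homeoProd (α := α) hG.hasSmoothAtlas).comp h1
  · rw [expSemidirect, expSemidirect, expSemidirect, homeoProd_mul, expLeft_add_smul hα hex]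
    congr 2
    exact hex.map_add_smul s t p.2
  · have h1 : HasDirDerivAt (fun t : ℝ => expLeft α ex (t • p)) 0 1 p.1 := by
      -- By linearity in the vector the difference quotient equals `expLeft α ex (p.1, t • p.2)`, so
      -- continuity alone gives the derivative.
      have h2 : Tendsto (fun t : ℝ => expLeft α ex (p.1, t • p.2)) (𝓝[≠] 0) (𝓝 p.1) :=
        (((continuous_expLeft hα hex).comp (by fun_prop :
          Continuous fun t : ℝ => (p.1, t • p.2))).tendsto' 0 _
          (by simp [expLeft_zero_snd hex])).mono_left nhdsWithin_le_nhds
      refine h2.congr' ?_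
      filter_upwards [self_mem_nhdsWithin] with t ht
      have h0 : expLeft α ex 0 = 0 := expLeft_zero_snd hex 0
      have h3 := expLeft_smul_fst (α := α) hα hex t p.1 (t • p.2)
      rw [smul_eq_mul, mul_one, zero_add, zero_smul, h0, sub_zero, eq_inv_smul_iff₀ ht, ← h3]
      rfl
    -- The preferred chart at `1` is, by definition, the identity of `V` times the preferred chart
    -- of `G` at `1`.
    exact h1.prodMk (hex.deriv_zero p.2)

end VecSemidirect

end Exponential

/-! ### Trotter products and continuous convergence -/

section ContinuousConvergence

variable {G : Type*} [Group G] [TopologicalSpace G] [IsTopologicalGroup G] {X X₁ X₂ : ℝ → G}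

/-- Locally uniform convergence to a continuous limit, as continuous convergence. -/
theorem IsTrotterSum.tendsto (h : IsTrotterSum X X₁ X₂) (hX : Continuous X) (t : ℝ) :
    Tendsto (fun p : ℝ × ℕ => (X₁ (p.1 / p.2) * X₂ (p.1 / p.2)) ^ p.2) (𝓝 t ×ˢ atTop)
      (𝓝 (X t)) := by
  have h1 : Tendsto (fun p : ℝ × ℕ => (X p.1)⁻¹ * (X₁ (p.1 / p.2) * X₂ (p.1 / p.2)) ^ p.2)
      (𝓝 t ×ˢ atTop) (𝓝 1) := by
    intro U hU
    obtain ⟨N, hN⟩ := h _ (isCompact_closedBall t 1) U hU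
    refine mem_map.2 (mem_of_superset
      (prod_mem_prod (Metric.closedBall_mem_nhds t one_pos) (Ici_mem_atTop N)) ?_)
    rintro ⟨s, n⟩ ⟨hs, hn⟩
    exact hN n hn s hs
  have h2 := ((hX.tendsto t).comp (tendsto_fst (g := (atTop : Filter ℕ)))).mul h1
  rw [mul_one] at h2
  exact h2.congr fun p => mul_inv_cancel_left _ _

/-- Continuity of `X` turns the hypothesis into convergence of `(X s)⁻¹` times the products to `1`
near each `t`, and compactness of `K` makes it uniform. -/
theorem isTrotterSum_of_tendsto (hX : Continuous X)
    (h : ∀ t, Tendsto (fun p : ℝ × ℕ => (X₁ (p.1 / p.2) * X₂ (p.1 / p.2)) ^ p.2) (𝓝 t ×ˢ atTop)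
      (𝓝 (X t))) : IsTrotterSum X X₁ X₂ := by
  intro K hK U hU
  have h1 : {p : ℝ × ℕ | (X p.1)⁻¹ * (X₁ (p.1 / p.2) * X₂ (p.1 / p.2)) ^ p.2 ∈ U} ∈
      𝓝ˢ K ×ˢ atTop := by
    refine hK.mem_nhdsSet_prod_of_forall fun t _ => ?_
    have h2 := ((hX.tendsto t).comp (tendsto_fst (g := (atTop : Filter ℕ)))).inv.mul (h t)
    rw [inv_mul_cancel] at h2
    exact h2 hU
  obtain ⟨S, hS, T, hT, hST⟩ := mem_prod_iff.1 h1
  obtain ⟨N, hN⟩ := mem_atTop_sets.1 hT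
  exact ⟨N, fun n hn s hs => hST (a := (s, n)) ⟨subset_of_mem_nhdsSet hS hs, hN n hn⟩⟩

/-- At time `0` the convergence is uniform over all numbers of factors: the hypothesis covers large
`k`, and continuity at `0` covers the finitely many remaining ones. -/
theorem tendsto_trotter_zero (h₁ : Continuous X₁) (h₂ : Continuous X₂) (h₁0 : X₁ 0 = 1)
    (h₂0 : X₂ 0 = 1)
    (h : Tendsto (fun p : ℝ × ℕ => (X₁ (p.1 / p.2) * X₂ (p.1 / p.2)) ^ p.2) (𝓝 0 ×ˢ atTop) (𝓝 1)) :
    Tendsto (fun p : ℝ × ℕ => (X₁ (p.1 / p.2) * X₂ (p.1 / p.2)) ^ p.2) (𝓝 0 ×ˢ ⊤) (𝓝 1) := by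
  intro U hU
  obtain ⟨S, hS, T, hT, hST⟩ := mem_prod_iff.1 (h hU)
  obtain ⟨N, hN⟩ := mem_atTop_sets.1 hT
  have h3 : ∀ᶠ r in 𝓝 (0 : ℝ), ∀ k ∈ Finset.range N, (X₁ (r / k) * X₂ (r / k)) ^ k ∈ U := by
    rw [Finset.eventually_all]
    intro k _
    exact (by fun_prop : Continuous fun r : ℝ => (X₁ (r / k) * X₂ (r / k)) ^ k).tendsto' 0 1
      (by simp [h₁0, h₂0]) hU
  refine mem_map.2 (mem_of_superset (prod_mem_prod (inter_mem hS h3) univ_mem) ?_)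
  rintro ⟨r, k⟩ ⟨⟨hr, hr'⟩, -⟩
  rcases lt_or_ge k N with hk | hk
  · exact hr' k (Finset.mem_range.2 hk)
  · exact hST (a := (r, k)) ⟨hr, hN k hk⟩

/-- Convergence of the partial Trotter products, uniformly in the number of factors. -/
theorem IsTrotterSum.tendsto_floor (h : IsTrotterSum X X₁ X₂) (hX : Continuous X)
    (h₁ : Continuous X₁) (h₂ : Continuous X₂) (h0 : X 0 = 1) (h₁0 : X₁ 0 = 1) (h₂0 : X₂ 0 = 1)
    {σ : ℝ} (hσ : 0 ≤ σ) (t : ℝ) :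
    Tendsto (fun p : ℝ × (ℝ × ℕ) => (X₁ (p.1 * p.2.1 / (⌊p.1 * p.2.2⌋₊ : ℕ)) *
      X₂ (p.1 * p.2.1 / (⌊p.1 * p.2.2⌋₊ : ℕ))) ^ ⌊p.1 * p.2.2⌋₊) (𝓝 σ ×ˢ (𝓝 t ×ˢ atTop))
      (𝓝 (X (σ * t))) := by
  have hr : Tendsto (fun p : ℝ × (ℝ × ℕ) => p.1 * p.2.1) (𝓝 σ ×ˢ (𝓝 t ×ˢ atTop)) (𝓝 (σ * t)) :=
    tendsto_fst.mul (tendsto_fst.comp tendsto_snd)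
  -- At `σ = 0` the number of factors need not tend to infinity, so convergence must hold along `⊤`
  -- in that variable; for `σ > 0` it does tend to infinity.
  rcases hσ.eq_or_lt with rfl | hσ
  · rw [zero_mul] at hr ⊢
    have h3 := h.tendsto hX 0
    rw [h0] at h3 ⊢
    exact (tendsto_trotter_zero h₁ h₂ h₁0 h₂0 h3).comp (hr.prodMk tendsto_top)
  · have hk : Tendsto (fun p : ℝ × (ℝ × ℕ) => ⌊p.1 * p.2.2⌋₊) (𝓝 σ ×ˢ (𝓝 t ×ˢ atTop)) atTop :=
      tendsto_nat_floor_atTop.comp (tendsto_fst.pos_mul_atTop hσ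
        (tendsto_natCast_atTop_atTop.comp (tendsto_snd.comp tendsto_snd)))
    exact (h.tendsto hX (σ * t)).comp (hr.prodMk hk)

end ContinuousConvergence

/-! ### The Trotter property of the semidirect product -/

section Trotter

variable {E : Type*} [AddCommGroup E] [Module ℝ E] [TopologicalSpace E] [IsTopologicalAddGroup E]
  [ContinuousSMul ℝ E] [LocallyConvexSpace ℝ E] [T2Space E]
  {G : Type*} [Group G] [TopologicalSpace G] [ChartedSpace E G]

theorem IsLCLieGroup.isTopologicalGroup (hG : IsLCLieGroup E G) : IsTopologicalGroup G where
  continuous_mul := hG.smooth_mul.1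
  continuous_inv := hG.smooth_inv.1

theorem IsExpFunction.continuous_curve {ex : E → G} (hex : IsExpFunction E ex) (x : E) :
    Continuous fun t : ℝ => ex (t • x) :=
  hex.smooth.1.comp (by fun_prop)

variable {V : Type*} [AddCommGroup V] [Module ℝ V] [UniformSpace V] [IsUniformAddGroup V]
  [ContinuousSMul ℝ V] [LocallyConvexSpace ℝ V] [T2Space V]
  {α : G →* (V ≃L[ℝ] V)} {ex : E → G}

namespace VecSemidirect

theorem homeoProd_pow (w : V) (g : G) (n : ℕ) :
    homeoProd α (w, g) ^ n = homeoProd α (∑ k ∈ Finset.range n, α (g ^ k) w, g ^ n) := by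
  induction n with
  | zero => simp [homeoProd_one]
  | succ n ih => rw [pow_succ, ih, homeoProd_mul, Finset.sum_range_succ, ← pow_succ]

/-- At the node `σ = k / n` the floor is `k` and `σ * t / k = t / n`, so the `k`-th power becomes a
`k`-step Trotter product at time `σ * t`. For `k = 0` the division by zero is harmless, the exponent
being `0`. -/
theorem sum_act_eq_riemannSum (X₁ X₂ : ℝ → G) (t : ℝ) {n : ℕ} (hn : n ≠ 0) (c : V) :
    ∑ k ∈ Finset.range n, α ((X₁ (t / n) * X₂ (t / n)) ^ k) ((n : ℝ)⁻¹ • c) =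
      riemannSum (fun σ => α ((X₁ (σ * t / (⌊σ * n⌋₊ : ℕ)) * X₂ (σ * t / (⌊σ * n⌋₊ : ℕ))) ^
        ⌊σ * n⌋₊) c) n := by
  have hn' : (n : ℝ) ≠ 0 := by exact_mod_cast hn
  rw [riemannSum, Finset.smul_sum]
  refine Finset.sum_congr rfl fun k _ => ?_
  rw [div_mul_cancel₀ _ hn', Nat.floor_natCast, map_smul]
  rcases eq_or_ne k 0 with rfl | hk
  · simp
  · have hk' : (k : ℝ) ≠ 0 := by exact_mod_cast hk
    have h1 : (k / n * t / k : ℝ) = t / n := by field_simp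
    rw [h1]

variable [CompleteSpace V]

theorem isTrotterSum_expSemidirect (hG : IsLCLieGroup E G) (hα : IsSmoothAction E α)
    (hex : IsExpFunction E ex) {x₁ x₂ : E}
    (h : IsTrotterSum (fun t => ex (t • (x₁ + x₂))) (fun t => ex (t • x₁)) fun t => ex (t • x₂))
    (v₁ v₂ : V) :
    IsTrotterSum (fun t => expSemidirect α ex (t • ((v₁, x₁) + (v₂, x₂))))
      (fun t => expSemidirect α ex (t • (v₁, x₁))) fun t => expSemidirect α ex (t • (v₂, x₂)) := by
  have := hG.isTopologicalGroup
  have := (isLCLieGroup hG hα).isTopologicalGroup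
  have hJ := continuous_expLeft hα hex
  have hact := continuous_act hα
  have hX₁ := hex.continuous_curve x₁
  have hX₂ := hex.continuous_curve x₂
  have hX := hex.continuous_curve (x₁ + x₂)
  refine isTrotterSum_of_tendsto ((isExpFunction hG hα hex).continuous_curve _) fun t => ?_
  have hfloor : ∀ σ ∈ Icc (0 : ℝ) 1, _ := fun σ hσ => h.tendsto_floor hX hX₁ hX₂
    (by simp [hex.map_zero]) (by simp [hex.map_zero]) (by simp [hex.map_zero]) hσ.1 t
  have hr : Tendsto (fun p : ℝ × ℕ => (p.1, p.1 / p.2)) (𝓝 t ×ˢ atTop) (𝓝 (t, 0)) := by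
    refine Tendsto.prodMk_nhds tendsto_fst ?_
    have h1 := (tendsto_fst (f := 𝓝 t)).mul
      ((tendsto_inv_atTop_nhds_zero_nat (𝕜 := ℝ)).comp (tendsto_snd (f := 𝓝 t)))
    rw [mul_zero] at h1
    exact h1
  -- With `q = (t, t / n)` this is `n` times the `V`-component of the product of the two
  -- exponentials at time `t / n`. Treating `t / n` as an independent variable makes it jointly
  -- continuous, including at the limit value `0`.
  let C : ℝ × ℝ → V := fun q => q.1 • expLeft α ex (v₁, q.2 • x₁) +
    α (ex (q.2 • x₁)) (q.1 • expLeft α ex (v₂, q.2 • x₂))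
  have hC : Continuous C := by
    refine .add (by fun_prop) (hact.comp (f := fun q : ℝ × ℝ =>
      (ex (q.2 • x₁), q.1 • expLeft α ex (v₂, q.2 • x₂))) ?_)
    exact .prodMk (hX₁.comp continuous_snd) (by fun_prop)
  have hC0 : C (t, 0) = t • (v₁ + v₂) := by
    simp only [C, zero_smul, expLeft_zero_snd hex, hex.map_zero, act_one, smul_add]
  have hCt : Tendsto (fun p : ℝ × ℕ => C (p.1, p.1 / p.2)) (𝓝 t ×ˢ atTop)
      (𝓝 (t • (v₁ + v₂))) := hC0 ▸ (hC.tendsto _).comp hr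
  -- The limit integral is by definition `expLeft` at `t • (v₁ + v₂, x₁ + x₂)`.
  have hleft := tendsto_riemannSum_of_locally (l := 𝓝 t ×ˢ atTop)
    (continuous_act_exp_curve hα hex (t • (v₁ + v₂), t • (x₁ + x₂)))
    (N := Prod.snd) tendsto_snd (b := fun σ (p : ℝ × ℕ) => α ((ex ((σ * p.1 / (⌊σ * p.2⌋₊ : ℕ)) • x₁) *
      ex ((σ * p.1 / (⌊σ * p.2⌋₊ : ℕ)) • x₂)) ^ ⌊σ * p.2⌋₊) (C (p.1, p.1 / p.2))) fun σ hσ => by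
      simp only [smul_smul]
      exact (hact.tendsto (_, _)).comp ((hfloor σ hσ).prodMk_nhds (hCt.comp tendsto_snd))
  have hright := h.tendsto hX t
  refine (((homeoProd α).continuous.tendsto _).comp (hleft.prodMk_nhds hright)).congr' ?_
  filter_upwards [tendsto_snd.eventually_ne_atTop 0] with p hp
  have hp' : (p.2 : ℝ) ≠ 0 := by exact_mod_cast hp
  have hw : ∀ (v : V) (x : E), expLeft α ex ((p.1 / p.2) • (v, x)) =
      (p.2 : ℝ)⁻¹ • p.1 • expLeft α ex (v, (p.1 / p.2) • x) := fun v x => by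
    rw [smul_smul, inv_mul_eq_div, ← expLeft_smul_fst hα hex]
    rfl
  simp only [Function.comp]
  rw [expSemidirect, expSemidirect, homeoProd_mul, homeoProd_pow, hw, hw, map_smul, ← smul_add]
  simp only [Prod.smul_snd]
  rw [sum_act_eq_riemannSum (fun t => ex (t • x₁)) (fun t => ex (t • x₂)) p.1 hp]

theorem hasTrotterProperty (hG : IsLCLieGroup E G) (hα : IsSmoothAction E α)
    (h : HasTrotterProperty E G) : HasTrotterProperty (V × E) (VecSemidirect α) := by
  obtain ⟨ex, hex, hT⟩ := h
  exact ⟨expSemidirect α ex, isExpFunction hG hα hex, fun p₁ p₂ =>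
    isTrotterSum_expSemidirect hG hα hex (hT p₁.2 p₂.2) p₁.1 p₂.1⟩

end VecSemidirect

end Trotter

theorem mainTheorem9
    {E : Type*} [AddCommGroup E] [Module ℝ E] [TopologicalSpace E] [IsTopologicalAddGroup E]
    [ContinuousSMul ℝ E] [LocallyConvexSpace ℝ E] [T2Space E]
    {G : Type*} [Group G] [TopologicalSpace G] [ChartedSpace E G]
    (hG : IsLCLieGroup E G)
    {V : Type*} [AddCommGroup V] [Module ℝ V] [UniformSpace V] [IsUniformAddGroup V]
    [ContinuousSMul ℝ V] [LocallyConvexSpace ℝ V] [T2Space V] [CompleteSpace V]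
    (α : G →* (V ≃L[ℝ] V)) (hα : IsSmoothAction E α) :
    IsLCLieGroup (V × E) (VecSemidirect α) ∧
      (HasTrotterProperty E G → HasTrotterProperty (V × E) (VecSemidirect α)) := by
  exact ⟨VecSemidirect.isLCLieGroup hG hα, VecSemidirect.hasTrotterProperty hG hα⟩
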